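/- Let $n\ge 1$, let $X,Y,Z$ be the Pauli matrices and let $\gamma_{2j-1}=Z_1\cdots Z_{j-1}X_j$, $\gamma_{2j}=Z_1\cdots Z_{j-1}Y_j$ ($1\le j\le n$) be the Majorana operators on $n$ qubits. For $S\subseteq[2n]$ let $\gamma[S]=\prod_{s\in S}\gamma_s$ (increasing order), and let $P_k=2^{-n}\sum_{|S|=k}|\gamma[S]\rangle\langle\gamma[S]|$ be the orthogonal projection, for the inner product $\langle A|B\rangle=\operatorname{tr}(A^\dagger B)$, onto the span of the $\gamma[S]$ with $|S|=k$. The generalized matchgate group $\mathcal M_n^+$ is generated by the gates $\exp(i\alpha\,P\otimes P')$ on neighbouring qubits with $P,P'\in\{X,Y\}$, the gates $\exp(i\theta Z_j)$ and the gate $X_n$. For $Q\in O(2n)$ let $U(Q)\in\mathcal M_n^+$ satisfy $U(Q)\gamma_jU(Q)^\dagger=\sum_kQ_{kj}\gamma_k$ for all $j$ (it is unique up to a phase), and let $\omega(Q)(\rho)=U(Q)\rho U(Q)^\dagger$. Let the device implement $U(Q)$ by the superoperator $\Phi(Q)$. Let $\rho_0$ and $\tilde\rho_0$ be the ideal and the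 actual initial state (density matrices), $\{E_x\}$ and $\{\tilde E_x\}$, $x\in\{0,1\}^n$, the ideal and the actual measurement (POVMs), and let $N_k\in\mathbb R\setminus\{0\}$ be a normalization. For $0\le k\le 2n$ and $m\ge1$ define, with normalized Haar measure on $O(2n)$, $$f_k(m)=\int dQ_1\cdots dQ_m\sum_x\alpha_k(x,Q_m\cdots Q_1)\,\operatorname{tr}\bigl(\tilde E_x\,\Phi(Q_m)\cdots\Phi(Q_1)(\tilde\rho_0)\bigr),\qquad \alpha_k(x,Q)=\tfrac1{N_k}\operatorname{tr}\bigl(E_xP_k(\omega(Q)(\rho_0))\bigr).$$ (1) Assume gate-independent noise, i.e. $\Phi(Q)=\Lambda\circ\omega(Q)$ for all $Q$, where $\Lambda$ is a quantum channel (completely positive and trace preserving). Put $\lambda_k=\operatorname{tr}(P_k\Lambda)/\binom{2n}{k}$, which depends only on $\Lambda$ and is real, and $$B_k=\frac1{N_k}\sum_x\binom{2n}{k}^{-1}\langle E_x\otimes\Lambda^\dagger(\tilde E_x)|v_k\rangle\langle v_k|\rho_0\otimes\tilde\rho_0\rangle,\qquad v_k=2^{-n}\sum_{|S|=k}\gamma[S]\otimes\gamma[S].$$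 Then $f_k(m)=B_k\lambda_k^{m-1}$ for all $m\ge1$ and $0\le k\le 2n$. In particular, if $\lambda_k\ne0$, then $f_k(m)=A_k\lambda_k^m$ for all $m\ge1$, with $A_k=B_k/\lambda_k$. (2) For every quantum channel $\Lambda$, $$2^{-n}\sum_{k=0}^{2n}\binom{2n}{k}\lambda_k=(2^n+1)F_{\mathrm{avg}}(\Lambda)-1,$$ where $F_{\mathrm{avg}}(\Lambda)=\int\langle\psi|\Lambda(|\psi\rangle\langle\psi|)|\psi\rangle\,d\psi$ is the average over Haar-random pure states $\psi$. (3) In the noise-free limit ($\Lambda=\mathrm{id}$, $\tilde\rho_0=\rho_0$, $\tilde E_x=E_x$) one has $\lambda_k=1$, hence $A_k=B_k$. For even $k$ and $Z$-basis SPAM ($\rho_0=|0\rangle\langle0|^{\otimes n}$, $E_x=|x\rangle\langle x|$), $A_k=1$ if and only if $$N_k=2^{-n}\binom{n}{k/2}^2\binom{2n}{k}^{-1}.$$ For odd $k$ and $X$-basis SPAM ($\rho_0=|+\rangle\langle+|^{\otimes n}$, $E_x=H^{\otimes n}|x\rangle\langle x|H^{\otimes n}$), $A_k=1$ if and only if $$N_k=2^{-n}\binom{n-1}{(k-1)/2}^2\binom{2n}{k}^{-1}.$$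 With these normalizations $f_k(m)=1$ for all $m\ge1$ in the noise-free limit. -/

import Mathlib

open scoped Matrix BigOperators ComplexOrder
open MeasureTheory

noncomputable section

namespace MatchgateBenchmarking

/-! ### Haar probability measure on the orthogonal and unitary groups -/

section Haar

variable {ι 𝕜 : Type*} [Fintype ι] [DecidableEq ι] [RCLike 𝕜]

instance instCompactSpaceUnitaryGroup : CompactSpace (Matrix.unitaryGroup ι 𝕜) := by
  have hb : IsCompact
      (Set.pi Set.univ fun _ : ι => Set.pi Set.univ fun _ : ι => Metric.closedBall (0 : 𝕜) 1) :=
    isCompact_univ_pi fun _ => isCompact_univ_pi fun _ => isCompact_closedBall _ _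
  have hsub : ((Matrix.unitaryGroup ι 𝕜 : Submonoid (Matrix ι ι 𝕜)) : Set (Matrix ι ι 𝕜)) ⊆
      Set.pi Set.univ fun _ : ι => Set.pi Set.univ fun _ : ι => Metric.closedBall (0 : 𝕜) 1 := by
    intro A hA i _ j _
    simpa using entry_norm_bound_of_unitary hA i j
  have hc : IsClosed
      ((Matrix.unitaryGroup ι 𝕜 : Submonoid (Matrix ι ι 𝕜)) : Set (Matrix ι ι 𝕜)) :=
    isClosed_unitary
  exact isCompact_iff_compactSpace.mp (IsCompact.of_isClosed_subset hb hc hsub)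

instance instMeasurableSpaceUnitaryGroup : MeasurableSpace (Matrix.unitaryGroup ι 𝕜) := borel _

instance instBorelSpaceUnitaryGroup : BorelSpace (Matrix.unitaryGroup ι 𝕜) := ⟨rfl⟩

/-- The Haar measure of total mass one on the unitary group `U(ι)` (for `𝕜 = ℂ`), respectively
on the orthogonal group `O(ι)` (for `𝕜 = ℝ`). -/
def haarProb (ι 𝕜 : Type*) [Fintype ι] [DecidableEq ι] [RCLike 𝕜] :
    Measure (Matrix.unitaryGroup ι 𝕜) :=
  Measure.haarMeasure ⊤

end Haar

/-! ### Qubits and Pauli matrices -/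

/-- Bit strings `{0,1}ⁿ`, the labels of the computational basis of `n` qubits. -/
abbrev Bits (n : ℕ) : Type := Fin n → Fin 2

/-- Linear operators on the space of `n` qubits. -/
abbrev Op (n : ℕ) : Type := Matrix (Bits n) (Bits n) ℂ

/-- Superoperators: linear maps on the space of `n`-qubit operators. -/
abbrev SuperOp (n : ℕ) : Type := Op n →ₗ[ℂ] Op n

def pauliX : Matrix (Fin 2) (Fin 2) ℂ := !![0, 1; 1, 0]

def pauliY : Matrix (Fin 2) (Fin 2) ℂ := !![0, -Complex.I; Complex.I, 0]

def pauliZ : Matrix (Fin 2) (Fin 2) ℂ := !![1, 0; 0, -1]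

def hadamard : Matrix (Fin 2) (Fin 2) ℂ :=
  ((Real.sqrt 2 : ℝ) : ℂ)⁻¹ • !![1, 1; 1, -1]

/-- The tensor product `A 0 ⊗ A 1 ⊗ ⋯ ⊗ A (n-1)` of one-qubit operators. -/
def tensorOp {n : ℕ} (A : Fin n → Matrix (Fin 2) (Fin 2) ℂ) : Op n :=
  Matrix.of fun x y => ∏ i, A i (x i) (y i)

/-- The one-qubit operator `A` acting on qubit `j`. -/
def onQubit {n : ℕ} (j : Fin n) (A : Matrix (Fin 2) (Fin 2) ℂ) : Op n :=
  tensorOp fun i => if i = j then A else 1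

/-! ### Majorana operators -/

/-- The `2n` Majorana operators, indexed from `0`: `majorana (2j)` is `Z ⋯ Z X I ⋯ I` and
`majorana (2j+1)` is `Z ⋯ Z Y I ⋯ I`, where the `X`, respectively `Y`, is on qubit `j`
(qubits are numbered from `0` as well). -/
def majorana {n : ℕ} (s : Fin (2 * n)) : Op n :=
  tensorOp fun i =>
    if i.val < s.val / 2 then pauliZ
    else if i.val = s.val / 2 then (if s.val % 2 = 0 then pauliX else pauliY)
    else 1

/-- `γ[S]`, the product of the Majorana operators in `S` in increasing order. -/
def majoranaProd {n : ℕ} (S : Finset (Fin (2 * n))) : Op n :=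
  ((S.sort (· ≤ ·)).map majorana).prod

/-- `P_k = 2⁻ⁿ ∑_{|S| = k} |γ[S]⟩⟨γ[S]|`, the orthogonal projection (for the trace inner product)
onto the span of the products of `k` distinct Majorana operators. -/
def majoranaProj (n k : ℕ) : SuperOp n :=
  ∑ S ∈ Finset.powersetCard k (Finset.univ : Finset (Fin (2 * n))),
    ((2 : ℂ) ^ n)⁻¹ •
      (Matrix.traceLinearMap (Bits n) ℂ ℂ ∘ₗ
        LinearMap.mulLeft ℂ (majoranaProd S)ᴴ).smulRight (majoranaProd S)

/-! ### Generalized matchgates -/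

/-- The matchgate group `M_n`, generated by the nearest-neighbour gates `exp(iα P ⊗ P')` with
`P, P' ∈ {X, Y}` and by the one-qubit gates `exp(iθ Z)`. -/
def matchgateGroup (n : ℕ) : Subgroup (Matrix.unitaryGroup (Bits n) ℂ) :=
  Subgroup.closure
    ({U | ∃ i j : Fin n, j.val = i.val + 1 ∧
        ∃ P ∈ ({pauliX, pauliY} : Set (Matrix (Fin 2) (Fin 2) ℂ)),
        ∃ P' ∈ ({pauliX, pauliY} : Set (Matrix (Fin 2) (Fin 2) ℂ)),
        ∃ α : ℝ, (U : Op n) =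
          NormedSpace.exp ((Complex.I * (α : ℂ)) • (onQubit i P * onQubit j P'))} ∪
     {U | ∃ (j : Fin n) (θ : ℝ),
        (U : Op n) = NormedSpace.exp ((Complex.I * (θ : ℂ)) • onQubit j pauliZ)})

/-- The generalized matchgate group `M_n⁺`: matchgates together with `X` on the last qubit. -/
def genMatchgateGroup (n : ℕ) : Subgroup (Matrix.unitaryGroup (Bits n) ℂ) :=
  matchgateGroup n ⊔
    Subgroup.closure {U | ∃ j : Fin n, j.val + 1 = n ∧ (U : Op n) = onQubit j pauliX}

/-- The unitary `U` implements `Q ∈ O(2n)`: `U γ_j U† = ∑_k Q_{kj} γ_k` for all `j`. -/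
def Implements {n : ℕ} (U : Matrix.unitaryGroup (Bits n) ℂ)
    (Q : Matrix.orthogonalGroup (Fin (2 * n)) ℝ) : Prop :=
  ∀ j, (U : Op n) * majorana j * (U : Op n)ᴴ =
    ∑ k, (((Q : Matrix (Fin (2 * n)) (Fin (2 * n)) ℝ) k j : ℝ) : ℂ) • majorana k

/-- `U(Q)`: a generalized matchgate that implements `Q`. It is unique up to a phase, so the
conjugation action `omega` below does not depend on the choice. -/
def genMatchgate {n : ℕ} (Q : Matrix.orthogonalGroup (Fin (2 * n)) ℝ) :
    Matrix.unitaryGroup (Bits n) ℂ :=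
  Classical.epsilon fun U => U ∈ genMatchgateGroup n ∧ Implements U Q

/-- `ω(Q)(ρ) = U(Q) ρ U(Q)†`. -/
def omega {n : ℕ} (Q : Matrix.orthogonalGroup (Fin (2 * n)) ℝ) : SuperOp n :=
  LinearMap.mulLeft ℂ (genMatchgate Q : Op n) ∘ₗ
    LinearMap.mulRight ℂ (genMatchgate Q : Op n)ᴴ

/-! ### States, measurements, channels -/

def IsDensity {n : ℕ} (ρ : Op n) : Prop := ρ.PosSemidef ∧ ρ.trace = 1

/-- A POVM with outcomes in `{0,1}ⁿ`. -/
def IsPOVM {n : ℕ} (E : Bits n → Op n) : Prop := (∀ x, (E x).PosSemidef) ∧ ∑ x, E x = 1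

/-- `Λ ⊗ id_d`, acting block by block. -/
def ampliation {n : ℕ} (Λ : SuperOp n) (d : ℕ)
    (M : Matrix (Bits n × Fin d) (Bits n × Fin d) ℂ) :
    Matrix (Bits n × Fin d) (Bits n × Fin d) ℂ :=
  Matrix.of fun p q => Λ (Matrix.of fun x y => M (x, p.2) (y, q.2)) p.1 q.1

/-- A quantum channel: a completely positive, trace-preserving linear map. -/
def IsChannel {n : ℕ} (Λ : SuperOp n) : Prop :=
  (∀ (d : ℕ) (M : Matrix (Bits n × Fin d) (Bits n × Fin d) ℂ),
    M.PosSemidef → (ampliation Λ d M).PosSemidef) ∧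
  ∀ ρ : Op n, (Λ ρ).trace = ρ.trace

/-- `|ψ⟩⟨ψ|` for the pure state `ψ = V|0…0⟩`. -/
def pureState {n : ℕ} (V : Matrix.unitaryGroup (Bits n) ℂ) : Op n :=
  (V : Op n) * Matrix.single 0 0 1 * (V : Op n)ᴴ

/-- The average gate fidelity `∫ ⟨ψ|Λ(|ψ⟩⟨ψ|)|ψ⟩ dψ`, for a uniformly random pure state `ψ`. -/
def avgFidelity {n : ℕ} (Λ : SuperOp n) : ℂ :=
  ∫ V, (pureState V * Λ (pureState V)).trace ∂(haarProb (Bits n) ℂ)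

/-- The ideal `Z`-basis measurement `E_x = |x⟩⟨x|`. -/
def zEffect {n : ℕ} (x : Bits n) : Op n := Matrix.single x x 1

/-- The ideal `X`-basis measurement `E_x = H^{⊗n}|x⟩⟨x|H^{⊗n}`. -/
def xEffect {n : ℕ} (x : Bits n) : Op n :=
  tensorOp (fun _ => hadamard) * Matrix.single x x 1 * tensorOp (fun _ => hadamard)

/-- The all-zero state `|0…0⟩⟨0…0|`. -/
def zState (n : ℕ) : Op n := zEffect 0

/-- The all-plus state `|+…+⟩⟨+…+|`. -/
def xState (n : ℕ) : Op n := xEffect 0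

/-! ### The benchmarking data -/

/-- The correlation function `α_k(x,Q) = N⁻¹ tr(E_x P_k(U(Q) ρ₀ U(Q)†))`, for ideal initial state
`ρ₀`, ideal measurement `E` and normalization `N`. -/
def corrFun {n : ℕ} (k : ℕ) (N : ℝ) (ρ₀ : Op n) (E : Bits n → Op n) (x : Bits n)
    (Q : Matrix.orthogonalGroup (Fin (2 * n)) ℝ) : ℂ :=
  (N : ℂ)⁻¹ * (E x * majoranaProj n k (omega Q ρ₀)).trace

/-- The probability `tr(Ẽ_x Φ(Q_m) ⋯ Φ(Q_1)(ρ̃₀))` of the outcome `x` when the gates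
`Q_1, …, Q_m` are run in this order, `Φ(Q)` is the device's implementation of `U(Q)`, and
`ρ̃₀`, `Ẽ` are the actual initial state and measurement. -/
def outcomeProb {n m : ℕ} (Φ : Matrix.orthogonalGroup (Fin (2 * n)) ℝ → SuperOp n)
    (ρ' : Op n) (E' : Bits n → Op n) (x : Bits n)
    (Q : Fin m → Matrix.orthogonalGroup (Fin (2 * n)) ℝ) : ℂ :=
  (E' x * ((List.ofFn fun i => (Φ (Q i) : Module.End ℂ (Op n))).reverse.prod) ρ').trace

/-- `f_k(m) = ∫ dQ_1 ⋯ dQ_m ∑_x α_k(x, Q_m ⋯ Q_1) p(x | Q_1, …, Q_m)`, the `Q_i` being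
independent and Haar distributed on `O(2n)`. -/
def decayData {n : ℕ} (k : ℕ) (N : ℝ) (ρ₀ : Op n) (E : Bits n → Op n)
    (Φ : Matrix.orthogonalGroup (Fin (2 * n)) ℝ → SuperOp n)
    (ρ' : Op n) (E' : Bits n → Op n) (m : ℕ) : ℂ :=
  ∫ Q : Fin m → Matrix.orthogonalGroup (Fin (2 * n)) ℝ,
    ∑ x, corrFun k N ρ₀ E x (List.ofFn Q).reverse.prod * outcomeProb Φ ρ' E' x Q
    ∂(Measure.pi fun _ => haarProb (Fin (2 * n)) ℝ)

/-- The Majorana fidelity `λ_k = tr(P_k Λ) / binom(2n, k)`. -/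
def majoranaFidelity {n : ℕ} (Λ : SuperOp n) (k : ℕ) : ℂ :=
  LinearMap.trace ℂ (Op n) (majoranaProj n k ∘ₗ Λ) / ((2 * n).choose k : ℂ)

/-- The amplitude
`B_k = N⁻¹ ∑_x binom(2n,k)⁻¹ ⟨E_x ⊗ Λ†(Ẽ_x) | v_k⟩ ⟨v_k | ρ₀ ⊗ ρ̃₀⟩`, where
`v_k = 2⁻ⁿ ∑_{|S| = k} γ[S] ⊗ γ[S]` and `⟨A | B⟩ = tr(A†B)`; here `tr(Λ†(Ẽ_x)† γ[S])` is
written as `tr(Ẽ_x† Λ(γ[S]))`. -/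
def amplitude {n : ℕ} (k : ℕ) (N : ℝ) (ρ₀ : Op n) (E : Bits n → Op n) (Λ : SuperOp n)
    (ρ' : Op n) (E' : Bits n → Op n) : ℂ :=
  (N : ℂ)⁻¹ * ∑ x, ((2 * n).choose k : ℂ)⁻¹ *
    (((2 : ℂ) ^ n)⁻¹ * ∑ S ∈ Finset.powersetCard k (Finset.univ : Finset (Fin (2 * n))),
      ((E x)ᴴ * majoranaProd S).trace * ((E' x)ᴴ * Λ (majoranaProd S)).trace) *
    (((2 : ℂ) ^ n)⁻¹ * ∑ S ∈ Finset.powersetCard k (Finset.univ : Finset (Fin (2 * n))),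
      ((majoranaProd S)ᴴ * ρ₀).trace * ((majoranaProd S)ᴴ * ρ').trace)

/-- Normalization for `Z`-basis SPAM (used for even `k`). -/
def normZ (n k : ℕ) : ℝ :=
  (2 ^ n : ℝ)⁻¹ * (n.choose (k / 2) : ℝ) ^ 2 * ((2 * n).choose k : ℝ)⁻¹

/-- Normalization for `X`-basis SPAM (used for odd `k`). -/
def normX (n k : ℕ) : ℝ :=
  (2 ^ n : ℝ)⁻¹ * ((n - 1).choose (k / 2) : ℝ) ^ 2 * ((2 * n).choose k : ℝ)⁻¹

end MatchgateBenchmarking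

end

/-!
The superoperators `ω(Q)` are algebra automorphisms, determined by `ω(Q)(γ_j) = ∑_k Q_{kj} γ_k`.
For this formula one needs that each `Q ∈ O(2n)` is implemented by some generalized matchgate: the
gates `exp(iα X_i X_{i+1})` and `exp(iθ Z_j)` are the exponentials `exp(α γ_a γ_{a+1})`, which
implement the rotations in the planes of adjacent coordinates, and `X` on the last qubit implements
a reflection. By Gaussian elimination these generate `O(2n)` (`implementable_eq_top`).

The matrix entries of `ω(Q)` in the orthogonal basis of the products `γ[S]` vanish between different
degrees, because `ω(Q)` commutes with `A ↦ ∑_j γ_j A γ_j`, whose eigenvalue `(-1)^k (2n - 2k)` on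
products of degree `k` determines `k`. Their second moments (`integral_omegaCoeff_mul`) follow from
the invariance of the Haar measure alone, without representation theory: the sign changes of single
Majorana operators kill all the mixed moments, the permutations make the remaining ones of a fixed
degree equal, and the normalization `∑_T ω(Q)_{TS}² = 1` fixes their value `binom(2n,k)⁻¹`.

The function `f_k(m)` averages a bilinear form in the ideal output `ω(Q_m ⋯ Q_1) ρ₀` and the noisy
output `Λ ω(Q_m) ⋯ Λ ω(Q_1) ρ̃₀`. Averaging over `Q_1` replaces the pair of inputs by a
combination of the tensors `∑_{|S| = k} γ[S] ⊗ γ[S]`, and every further gate multiplies the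
component of degree `k` by `λ_k` (`circuitAverage_eq`, `decayData_eq`).

The Majorana fidelities are real since channels preserve hermiticity and `γ[S]† = ±γ[S]`. Their
sum with weights `binom(2n,k)` is the trace of `Λ`, which the second moment
`(1 + SWAP) / (d (d + 1))` of a random pure state relates to the average fidelity
(`vectorMoment_eq`, `avgFidelity_eq`).

In the noise-free limit the amplitude counts the `γ[S]` with non-zero expectation value in the
states of the measurement basis. For the `Z` basis these are the products of pairs
`γ_{2j} γ_{2j+1} = i Z_j`. For the `X` basis and odd degree they are the products of
`γ_0 = X_0` with pairs `γ_{2i+1} γ_{2i+2} = i X_i X_{i+1}`.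
-/

namespace MatchgateBenchmarking

/-! ### Tensor products of one-qubit operators and the Majorana relations -/

theorem tensorOp_mul {n : ℕ} (A B : Fin n → Matrix (Fin 2) (Fin 2) ℂ) :
    tensorOp A * tensorOp B = tensorOp fun i => A i * B i := by
  ext x y
  simp only [tensorOp, Matrix.mul_apply, Matrix.of_apply, Finset.prod_univ_sum,
    Fintype.piFinset_univ, ← Finset.prod_mul_distrib]

theorem tensorOp_conjTranspose {n : ℕ} (A : Fin n → Matrix (Fin 2) (Fin 2) ℂ) :
    (tensorOp A)ᴴ = tensorOp fun i => (A i)ᴴ := by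
  ext x y
  simp [tensorOp]

theorem tensorOp_smul {n : ℕ} (c : Fin n → ℂ) (A : Fin n → Matrix (Fin 2) (Fin 2) ℂ) :
    (tensorOp fun i => c i • A i) = (∏ i, c i) • tensorOp A := by
  ext x y
  simp [tensorOp, Finset.prod_mul_distrib]

theorem tensorOp_one {n : ℕ} : (tensorOp fun _ : Fin n => 1) = 1 := by
  ext x y
  by_cases h : x = y
  · subst h; simp [tensorOp]
  · obtain ⟨i, hi⟩ := Function.ne_iff.mp h
    simp only [tensorOp, Matrix.of_apply, Matrix.one_apply_ne h]
    exact Finset.prod_eq_zero (Finset.mem_univ i) (Matrix.one_apply_ne hi)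

theorem tensorOp_mul_self {n : ℕ} {A : Fin n → Matrix (Fin 2) (Fin 2) ℂ}
    (h : ∀ i, A i * A i = 1) : tensorOp A * tensorOp A = 1 := by
  rw [tensorOp_mul, funext h, tensorOp_one]

/-- Tensor products anticommute when the tensor factors anticommute in exactly one place and
commute in all others. -/
theorem tensorOp_anticomm {n : ℕ} {A B : Fin n → Matrix (Fin 2) (Fin 2) ℂ} (j : Fin n)
    (hj : A j * B j = -(B j * A j)) (h : ∀ i, i ≠ j → A i * B i = B i * A i) :
    tensorOp A * tensorOp B = -(tensorOp B * tensorOp A) := by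
  rw [tensorOp_mul, tensorOp_mul]
  have : (fun i => A i * B i) = fun i => (if i = j then (-1 : ℂ) else 1) • (B i * A i) := by
    funext i
    by_cases hi : i = j
    · subst hi; simp [hj]
    · simp [hi, h i hi]
  rw [this, tensorOp_smul]
  simp

theorem tensorOp_comm {n : ℕ} {A B : Fin n → Matrix (Fin 2) (Fin 2) ℂ}
    (h : ∀ i, A i * B i = B i * A i) :
    tensorOp A * tensorOp B = tensorOp B * tensorOp A := by
  rw [tensorOp_mul, tensorOp_mul, funext h]

theorem pauliX_mul_self : pauliX * pauliX = 1 := by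
  ext i j; fin_cases i <;> fin_cases j <;> simp [pauliX]

theorem pauliY_mul_self : pauliY * pauliY = 1 := by
  ext i j; fin_cases i <;> fin_cases j <;> simp [pauliY]

theorem pauliZ_mul_self : pauliZ * pauliZ = 1 := by
  ext i j; fin_cases i <;> fin_cases j <;> simp [pauliZ]

theorem pauliX_mul_pauliY : pauliX * pauliY = Complex.I • pauliZ := by
  ext i j; fin_cases i <;> fin_cases j <;> simp [pauliX, pauliY, pauliZ]

theorem pauliY_mul_pauliX : pauliY * pauliX = -(Complex.I • pauliZ) := by
  ext i j; fin_cases i <;> fin_cases j <;> simp [pauliX, pauliY, pauliZ]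

theorem pauliY_mul_pauliZ : pauliY * pauliZ = Complex.I • pauliX := by
  ext i j; fin_cases i <;> fin_cases j <;> simp [pauliX, pauliY, pauliZ]

theorem pauliZ_mul_pauliY : pauliZ * pauliY = -(Complex.I • pauliX) := by
  ext i j; fin_cases i <;> fin_cases j <;> simp [pauliX, pauliY, pauliZ]

theorem pauliX_mul_pauliZ : pauliX * pauliZ = -(pauliZ * pauliX) := by
  ext i j; fin_cases i <;> fin_cases j <;> simp [pauliX, pauliZ]

theorem pauliX_conjTranspose : pauliXᴴ = pauliX := by
  ext i j; fin_cases i <;> fin_cases j <;> simp [pauliX]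

theorem pauliY_conjTranspose : pauliYᴴ = pauliY := by
  ext i j; fin_cases i <;> fin_cases j <;> simp [pauliY]

theorem pauliZ_conjTranspose : pauliZᴴ = pauliZ := by
  ext i j; fin_cases i <;> fin_cases j <;> simp [pauliZ]

theorem majorana_conjTranspose {n : ℕ} (s : Fin (2 * n)) :
    (majorana s : Op n)ᴴ = majorana s := by
  rw [majorana, tensorOp_conjTranspose]
  congr 1; funext i
  split_ifs <;> simp [pauliX_conjTranspose, pauliY_conjTranspose, pauliZ_conjTranspose]

theorem majorana_mul_self {n : ℕ} (s : Fin (2 * n)) :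
    (majorana s : Op n) * majorana s = 1 := by
  apply tensorOp_mul_self
  intro i
  split_ifs <;> simp [pauliX_mul_self, pauliY_mul_self, pauliZ_mul_self]

theorem majorana_anticomm {n : ℕ} {s t : Fin (2 * n)} (h : s ≠ t) :
    (majorana s : Op n) * majorana t = -(majorana t * majorana s) := by
  wlog hst : s < t generalizing s t
  · rw [this h.symm (lt_of_le_of_ne (not_lt.mp hst) h.symm), neg_neg]
  have hs := s.2
  have ht := t.2
  have hlt : s.val < t.val := hst
  refine tensorOp_anticomm ⟨s.val / 2, by omega⟩ ?_ ?_
  · by_cases h2 : s.val / 2 = t.val / 2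
    · have e1 : s.val % 2 = 0 := by omega
      have e2 : ¬ t.val % 2 = 0 := by omega
      simp [h2, e1, e2, pauliX_mul_pauliY, pauliY_mul_pauliX]
    · have e1 : s.val / 2 < t.val / 2 := by omega
      simp only [lt_irrefl, if_false, if_true, e1]
      split_ifs <;> simp [pauliX_mul_pauliZ, pauliY_mul_pauliZ, pauliZ_mul_pauliY]
  · intro i hi
    have hi' : i.val ≠ s.val / 2 := fun h => hi (Fin.ext h)
    simp only [hi', if_false]
    by_cases h1 : i.val < s.val / 2
    · have h2 : i.val < t.val / 2 := by omega
      simp [h1, h2]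
    · simp [h1]

/-- `γ_a γ_b = i Z_j` for `a = 2j`, `b = 2j + 1`. -/
theorem majorana_mul_majorana_eq_pauliZ {n : ℕ} (j : Fin n) {a b : Fin (2 * n)}
    (ha : a.val = 2 * j.val) (hb : b.val = 2 * j.val + 1) :
    (majorana a : Op n) * majorana b = Complex.I • onQubit j pauliZ := by
  have : (Complex.I • onQubit j pauliZ : Op n) =
      (∏ i : Fin n, if i = j then Complex.I else 1) • onQubit j pauliZ := by simp
  rw [majorana, majorana, tensorOp_mul, this, onQubit, ← tensorOp_smul]
  congr 1; funext i
  have e1 : a.val / 2 = j.val := by omega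
  have e2 : b.val / 2 = j.val := by omega
  have e3 : a.val % 2 = 0 := by omega
  have e4 : b.val % 2 = 1 := by omega
  simp only [e1, e2, e3, e4]
  rcases lt_trichotomy i j with h | h | h
  · have h' : i.val < j.val := h
    simp [h', h.ne, pauliZ_mul_self]
  · subst h; simp [pauliX_mul_pauliY]
  · have h' : ¬ i.val < j.val := not_lt.mpr h.le
    have h'' : ¬ i.val = j.val := fun e => h.ne' (Fin.ext e)
    simp [h', h'', h.ne']

/-- `γ_a γ_b = i X_i X_j` for `a = 2i + 1`, `b = 2i + 2`, `j = i + 1`. -/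
theorem majorana_mul_majorana_eq_pauliX {n : ℕ} {i j : Fin n} (hij : j.val = i.val + 1)
    {a b : Fin (2 * n)} (ha : a.val = 2 * i.val + 1) (hb : b.val = 2 * i.val + 2) :
    (majorana a : Op n) * majorana b = Complex.I • (onQubit i pauliX * onQubit j pauliX) := by
  have : ∀ M : Op n, Complex.I • M = (∏ l : Fin n, if l = i then Complex.I else 1) • M := by simp
  rw [this, onQubit, onQubit, majorana, majorana, tensorOp_mul, tensorOp_mul, ← tensorOp_smul]
  congr 1; funext l
  have e1 : a.val / 2 = i.val := by omega
  have e2 : b.val / 2 = i.val + 1 := by omega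
  have e3 : a.val % 2 = 1 := by omega
  have e4 : b.val % 2 = 0 := by omega
  simp only [e1, e2, e3, e4]
  have hne : i ≠ j := fun e => by rw [e] at hij; omega
  rcases lt_trichotomy l i with h | h | h
  · have h' : l.val < i.val := h
    have h2 : l.val < i.val + 1 := by omega
    have h3 : l ≠ j := fun e => by rw [e] at h'; omega
    simp [h', h2, h.ne, h3, pauliZ_mul_self]
  · subst h; simp [hne, pauliY_mul_pauliZ]
  · have h' : ¬ l.val < i.val := not_lt.mpr h.le
    have h'' : ¬ l.val = i.val := fun e => h.ne' (Fin.ext e)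
    have h3 : ¬ l.val < i.val + 1 := by omega
    by_cases hj : l = j
    · subst hj; simp [hij, hne.symm]
    · have h4 : ¬ l.val = i.val + 1 := fun e => hj (Fin.ext (by omega))
      simp [h', h'', h3, h4, hj, h.ne']

theorem onQubit_mul_self {n : ℕ} (j : Fin n) {A : Matrix (Fin 2) (Fin 2) ℂ} (h : A * A = 1) :
    onQubit j A * onQubit j A = 1 := by
  apply tensorOp_mul_self
  intro i; split_ifs <;> simp [h]

theorem onQubit_conjTranspose {n : ℕ} (j : Fin n) (A : Matrix (Fin 2) (Fin 2) ℂ) :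
    (onQubit j A)ᴴ = onQubit j Aᴴ := by
  rw [onQubit, tensorOp_conjTranspose, onQubit]
  congr 1; funext i; split_ifs <;> simp

/-- `X` on the last qubit negates the last Majorana operator under conjugation and fixes all
others. -/
theorem onQubit_last_conj_majorana {n : ℕ} {j : Fin n} (hj : j.val + 1 = n) (s : Fin (2 * n)) :
    onQubit j pauliX * majorana s * onQubit j pauliX =
      if s.val + 1 = 2 * n then -majorana s else majorana s := by
  have hs := s.2
  split_ifs with h
  · have : onQubit j pauliX * majorana s = -(majorana s * onQubit j pauliX) := by
      refine tensorOp_anticomm j ?_ ?_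
      · have e1 : s.val / 2 = j.val := by omega
        have e2 : s.val % 2 = 1 := by omega
        simp [e1, e2, pauliX_mul_pauliY, pauliY_mul_pauliX]
      · intro i hi; simp [hi]
    rw [this, neg_mul, mul_assoc, onQubit_mul_self j pauliX_mul_self, mul_one]
  · have : onQubit j pauliX * majorana s = majorana s * onQubit j pauliX := by
      refine tensorOp_comm fun i => ?_
      by_cases hi : i = j
      · subst hi
        have e1 : ¬ i.val < s.val / 2 := by omega
        by_cases e2 : i.val = s.val / 2
        · have e3 : s.val % 2 = 0 := by omega
          simp [← e2, e3]
        · simp [e1, e2]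
      · simp [hi]
    rw [this, mul_assoc, onQubit_mul_self j pauliX_mul_self, mul_one]

/-! ### Products of Majorana operators -/

/-- The ordered product of the Majorana operators with labels in a list. -/
def listProd {n : ℕ} (l : List (Fin (2 * n))) : Op n := (l.map majorana).prod

@[simp] theorem listProd_nil {n : ℕ} : (listProd [] : Op n) = 1 := rfl

@[simp] theorem listProd_cons {n : ℕ} (a : Fin (2 * n)) (l : List (Fin (2 * n))) :
    (listProd (a :: l) : Op n) = majorana a * listProd l := by simp [listProd]

theorem majorana_mul_listProd {n : ℕ} (j : Fin (2 * n)) {l : List (Fin (2 * n))} (hl : l.Nodup) :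
    majorana j * listProd l =
      ((-1 : ℂ) ^ l.length * if j ∈ l then -1 else 1) • (listProd l * majorana j) := by
  induction l with
  | nil => simp
  | cons a l ih =>
    obtain ⟨ha, hl⟩ := List.nodup_cons.mp hl
    have ih := ih hl
    rw [listProd_cons]
    by_cases h : j = a
    · subst h
      simp only [ha, if_false, mul_one] at ih
      simp only [List.mem_cons, true_or, if_true, List.length_cons]
      rw [mul_assoc (majorana j) (listProd l), show listProd l * majorana j =
        ((-1 : ℂ) ^ l.length) • (majorana j * listProd l) by
          rw [ih, smul_smul, ← mul_pow]; simp, mul_smul_comm, smul_smul]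
      ring_nf
      simp
    · rw [← mul_assoc, majorana_anticomm h, neg_mul, mul_assoc, ih, mul_smul_comm, mul_assoc,
        ← neg_smul]
      simp only [List.mem_cons, h, false_or, List.length_cons]
      ring_nf

/-- Reversal sign: `γ[S]† = ε_{|S|} γ[S]`, with `ε_k = (-1)^{k(k-1)/2}`. -/
theorem listProd_conjTranspose {n : ℕ} {l : List (Fin (2 * n))} (hl : l.Nodup) :
    (listProd l : Op n)ᴴ = ((-1 : ℂ) ^ l.length.choose 2) • listProd l := by
  induction l with
  | nil => simp
  | cons a l ih =>
    obtain ⟨ha, hl⟩ := List.nodup_cons.mp hl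
    rw [listProd_cons, Matrix.conjTranspose_mul, ih hl, majorana_conjTranspose,
      majorana_mul_listProd a hl, List.length_cons, Nat.choose_succ_succ' l.length 1]
    simp only [ha, if_false, mul_one, smul_smul, Matrix.smul_mul, Nat.choose_one_right,
      Nat.reduceAdd, pow_add]
    congr 1
    rw [mul_right_comm, ← mul_pow]; simp

theorem listProd_mul_conjTranspose {n : ℕ} (l : List (Fin (2 * n))) :
    (listProd l : Op n) * (listProd l)ᴴ = 1 := by
  induction l with
  | nil => simp
  | cons a l ih =>
    rw [listProd_cons, Matrix.conjTranspose_mul, mul_assoc, ← mul_assoc (listProd l), ih, one_mul,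
      majorana_conjTranspose, majorana_mul_self]

theorem listProd_perm {n : ℕ} {l l' : List (Fin (2 * n))} (h : l.Perm l') (hl : l.Nodup) :
    ∃ σ : ℂ, σ * σ = 1 ∧ (listProd l : Op n) = σ • listProd l' := by
  induction h with
  | nil => exact ⟨1, by simp, by simp⟩
  | cons a _ ih =>
    obtain ⟨σ, h1, h2⟩ := ih (List.nodup_cons.mp hl).2
    exact ⟨σ, h1, by simp [h2]⟩
  | swap a b l =>
    refine ⟨-1, by simp, ?_⟩
    have hab : b ≠ a := by
      rintro rfl; simp at hl
    simp only [listProd_cons, ← mul_assoc]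
    rw [majorana_anticomm hab]; simp
  | trans h1 _ ih1 ih2 =>
    obtain ⟨σ, h3, h4⟩ := ih1 hl
    obtain ⟨τ, h5, h6⟩ := ih2 (h1.nodup_iff.mp hl)
    exact ⟨σ * τ, by rw [mul_mul_mul_comm, h3, h5, one_mul], by rw [h4, h6, smul_smul]⟩

theorem majoranaProd_eq_listProd {n : ℕ} (S : Finset (Fin (2 * n))) :
    (majoranaProd S : Op n) = listProd (S.sort (· ≤ ·)) := rfl

/-- The sign `ε_k` in `γ[S]† = ε_{|S|} γ[S]`. -/
def reversalSign (k : ℕ) : ℂ := (-1) ^ k.choose 2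

theorem reversalSign_mul_self (k : ℕ) : reversalSign k * reversalSign k = 1 := by
  rw [reversalSign, ← mul_pow]; simp

theorem reversalSign_ne_zero (k : ℕ) : reversalSign k ≠ 0 := by simp [reversalSign]

theorem majoranaProd_conjTranspose {n : ℕ} (S : Finset (Fin (2 * n))) :
    (majoranaProd S : Op n)ᴴ = reversalSign S.card • majoranaProd S := by
  rw [majoranaProd_eq_listProd, listProd_conjTranspose (S.sort_nodup _), Finset.length_sort,
    reversalSign]

theorem majoranaProd_mul_conjTranspose {n : ℕ} (S : Finset (Fin (2 * n))) :
    (majoranaProd S : Op n) * (majoranaProd S)ᴴ = 1 := listProd_mul_conjTranspose _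

theorem majoranaProd_conjTranspose_mul {n : ℕ} (S : Finset (Fin (2 * n))) :
    (majoranaProd S : Op n)ᴴ * majoranaProd S = 1 :=
  mul_eq_one_comm.mp (majoranaProd_mul_conjTranspose S)

/-- The sign picked up by `γ[S]` under conjugation by `γ_j`. -/
def conjSign {n : ℕ} (S : Finset (Fin (2 * n))) (j : Fin (2 * n)) : ℂ :=
  (-1) ^ S.card * if j ∈ S then -1 else 1

theorem majorana_conj_majoranaProd {n : ℕ} (S : Finset (Fin (2 * n))) (j : Fin (2 * n)) :
    majorana j * majoranaProd S * majorana j = conjSign S j • (majoranaProd S : Op n) := by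
  rw [majoranaProd_eq_listProd, majorana_mul_listProd j (S.sort_nodup _), Matrix.smul_mul,
    mul_assoc, majorana_mul_self, mul_one]
  simp [conjSign]

/-- Distinct sets of Majorana operators are told apart by conjugation with a single Majorana
operator. -/
theorem exists_conjSign_mul_eq_neg_one {n : ℕ} {S T : Finset (Fin (2 * n))} (h : S ≠ T) :
    ∃ j, conjSign S j * conjSign T j = -1 := by
  have key : ∀ j, conjSign S j * conjSign T j =
      (-1) ^ (S.card + T.card) * if (j ∈ S ↔ j ∈ T) then 1 else -1 := by
    intro j
    by_cases h1 : j ∈ S <;> by_cases h2 : j ∈ T <;> simp [conjSign, h1, h2, pow_add]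
  by_cases hp : Even (S.card + T.card)
  · obtain ⟨j, hj⟩ : ∃ j, ¬ (j ∈ S ↔ j ∈ T) := by
      by_contra hc
      push Not at hc
      exact h (Finset.ext hc)
    exact ⟨j, by rw [key, if_neg hj, hp.neg_one_pow, one_mul]⟩
  · obtain ⟨j, hj⟩ : ∃ j, (j ∈ S ↔ j ∈ T) := by
      by_contra hc
      push Not at hc
      -- otherwise `S` and `T` are complementary, so that `|S| + |T| = 2n` is even
      have : T = Sᶜ := by
        ext j
        rw [Finset.mem_compl]
        have := hc j
        tauto
      apply hp
      rw [this, Finset.card_add_card_compl, Fintype.card_fin]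
      exact even_two_mul n
    exact ⟨j, by rw [key, if_pos hj, (Nat.not_even_iff_odd.mp hp).neg_one_pow, mul_one]⟩

theorem trace_conj_majorana {n : ℕ} (j : Fin (2 * n)) (A : Op n) :
    (majorana j * A * majorana j).trace = A.trace := by
  rw [Matrix.trace_mul_comm, ← mul_assoc, majorana_mul_self, one_mul]

theorem trace_majoranaProd_mul {n : ℕ} (S T : Finset (Fin (2 * n))) :
    ((majoranaProd S : Op n)ᴴ * majoranaProd T).trace = if S = T then 2 ^ n else 0 := by
  split_ifs with h
  · subst h
    rw [majoranaProd_conjTranspose_mul]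
    simp
  · obtain ⟨j, hj⟩ := exists_conjSign_mul_eq_neg_one h
    rw [majoranaProd_conjTranspose, Matrix.smul_mul, Matrix.trace_smul]
    have h1 : majorana j * (majoranaProd S * majoranaProd T) * majorana j =
        (-1 : ℂ) • ((majoranaProd S : Op n) * majoranaProd T) := by
      rw [← hj, ← smul_mul_smul_comm, ← majorana_conj_majoranaProd, ← majorana_conj_majoranaProd]
      simp only [mul_assoc]
      rw [← mul_assoc (majorana j) (majorana j), majorana_mul_self, one_mul]
    have h2 := trace_conj_majorana j ((majoranaProd S : Op n) * majoranaProd T)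
    rw [h1, Matrix.trace_smul] at h2
    have h3 : ((majoranaProd S : Op n) * majoranaProd T).trace = 0 := by
      simp only [smul_eq_mul, neg_mul, one_mul] at h2
      linear_combination (-1 / 2 : ℂ) * h2
    rw [h3, smul_zero]

theorem trace_majoranaProd_mul' {n : ℕ} (S T : Finset (Fin (2 * n))) :
    ((majoranaProd S : Op n) * majoranaProd T).trace =
      if S = T then reversalSign S.card * 2 ^ n else 0 := by
  have h := trace_majoranaProd_mul S T
  rw [majoranaProd_conjTranspose, Matrix.smul_mul, Matrix.trace_smul, smul_eq_mul] at h
  have h2 : ∀ z : ℂ, z = reversalSign S.card * (reversalSign S.card * z) := fun z => by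
    rw [← mul_assoc, reversalSign_mul_self, one_mul]
  rw [h2 (Matrix.trace _), h]
  split_ifs <;> simp

/-- The coefficient of `γ[S]` in the Majorana expansion of an operator. -/
noncomputable def coeff {n : ℕ} (S : Finset (Fin (2 * n))) : Op n →ₗ[ℂ] ℂ :=
  ((2 : ℂ) ^ n)⁻¹ • (Matrix.traceLinearMap (Bits n) ℂ ℂ ∘ₗ LinearMap.mulLeft ℂ (majoranaProd S)ᴴ)

theorem coeff_apply {n : ℕ} (S : Finset (Fin (2 * n))) (A : Op n) :
    coeff S A = ((2 : ℂ) ^ n)⁻¹ * ((majoranaProd S)ᴴ * A).trace := rfl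

theorem coeff_majoranaProd {n : ℕ} (S T : Finset (Fin (2 * n))) :
    coeff S (majoranaProd T) = if S = T then 1 else 0 := by
  rw [coeff_apply, trace_majoranaProd_mul]
  split_ifs <;> simp

theorem linearIndependent_majoranaProd {n : ℕ} :
    LinearIndependent ℂ (majoranaProd : Finset (Fin (2 * n)) → Op n) := by
  rw [Fintype.linearIndependent_iff]
  intro g hg S
  have := congrArg (coeff S) hg
  simpa [coeff_majoranaProd] using this

/-- The `4ⁿ` products `γ[S]` form a basis of the space of operators. -/
noncomputable def majoranaBasis (n : ℕ) : Module.Basis (Finset (Fin (2 * n))) ℂ (Op n) :=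
  basisOfLinearIndependentOfCardEqFinrank linearIndependent_majoranaProd (by
    rw [Module.finrank_matrix]
    simp [pow_mul, ← mul_pow])

theorem majoranaBasis_apply {n : ℕ} (S : Finset (Fin (2 * n))) :
    majoranaBasis n S = majoranaProd S := by
  simp [majoranaBasis]

theorem majoranaBasis_repr {n : ℕ} (S : Finset (Fin (2 * n))) (A : Op n) :
    (majoranaBasis n).repr A S = coeff S A := by
  conv_rhs => rw [← (majoranaBasis n).sum_repr A]
  simp [majoranaBasis_apply, coeff_majoranaProd]

theorem sum_coeff_smul {n : ℕ} (A : Op n) : ∑ S, coeff S A • majoranaProd S = A := by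
  conv_rhs => rw [← (majoranaBasis n).sum_repr A]
  simp [majoranaBasis_apply, majoranaBasis_repr]

theorem majoranaProj_apply {n : ℕ} (k : ℕ) (A : Op n) :
    majoranaProj n k A = ∑ S ∈ Finset.powersetCard k Finset.univ, coeff S A • majoranaProd S := by
  simp [majoranaProj, coeff_apply, smul_smul]

theorem majoranaProj_majoranaProd {n : ℕ} (k : ℕ) (S : Finset (Fin (2 * n))) :
    majoranaProj n k (majoranaProd S) = if S.card = k then majoranaProd S else 0 := by
  rw [majoranaProj_apply]
  simp [coeff_majoranaProd]

theorem trace_superOp {n : ℕ} (L : SuperOp n) :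
    LinearMap.trace ℂ (Op n) L = ∑ S, coeff S (L (majoranaProd S)) := by
  rw [LinearMap.trace_eq_matrix_trace ℂ (majoranaBasis n), Matrix.trace]
  simp [LinearMap.toMatrix_apply, majoranaBasis_apply, majoranaBasis_repr]

theorem trace_majoranaProj_comp {n : ℕ} (k : ℕ) (L : SuperOp n) :
    LinearMap.trace ℂ (Op n) (majoranaProj n k ∘ₗ L) =
      ∑ S ∈ Finset.powersetCard k Finset.univ, coeff S (L (majoranaProd S)) := by
  rw [trace_superOp]
  simp only [LinearMap.comp_apply, majoranaProj_apply, map_sum, map_smul, coeff_majoranaProd,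
    smul_eq_mul, mul_ite, mul_one, mul_zero]
  rw [Finset.sum_comm]
  simp

/-! ### Plane rotations and a reflection generate the orthogonal group -/

/-- The rotation by `θ` in the plane spanned by the coordinates `a` and `b`, which sends `e_a` to
`cos θ e_a + sin θ e_b`. -/
noncomputable def planeRotation {N : ℕ} (a b : Fin N) (hab : a ≠ b) (θ : ℝ) :
    Matrix.orthogonalGroup (Fin N) ℝ :=
  ⟨1 + (Real.cos θ - 1) • (Matrix.single a a 1 + Matrix.single b b 1) +
      Real.sin θ • (Matrix.single b a 1 - Matrix.single a b 1), by
    rw [Matrix.mem_orthogonalGroup_iff]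
    simp only [Matrix.transpose_add, Matrix.transpose_smul, Matrix.transpose_sub,
      Matrix.transpose_one, Matrix.transpose_single]
    set P : Matrix (Fin N) (Fin N) ℝ := Matrix.single a a 1 + Matrix.single b b 1 with hP
    set J : Matrix (Fin N) (Fin N) ℝ := Matrix.single b a 1 - Matrix.single a b 1 with hJ
    have hJ' : Matrix.single a b 1 - Matrix.single b a 1 = -J := by rw [hJ, neg_sub]
    have h1 : P * P = P := by
      simp [hP, add_mul, mul_add, hab, hab.symm]
    have h2 : P * J = J := by
      simp [hP, hJ, add_mul, mul_sub, hab, hab.symm]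
    have h3 : J * P = J := by
      simp [hP, hJ, sub_mul, mul_add, hab, hab.symm]
      abel
    have h4 : J * J = -P := by
      simp [hP, hJ, sub_mul, mul_sub, hab, hab.symm]; abel
    rw [hJ']
    simp only [add_mul, mul_add, one_mul, mul_one, smul_mul_assoc, mul_smul_comm, h1, h2, h3, h4,
      mul_neg, smul_neg]
    have : 2 * (Real.cos θ - 1) + (Real.cos θ - 1) * (Real.cos θ - 1) +
        Real.sin θ * Real.sin θ = 0 := by
      linear_combination Real.sin_sq_add_cos_sq θ
    have h5 := congrArg (· • P) this
    simp only [add_smul, two_mul, zero_smul] at h5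
    rw [← sub_eq_zero, ← h5]
    module⟩

theorem planeRotation_mul_apply {N : ℕ} (a b : Fin N) (hab : a ≠ b) (θ : ℝ)
    (M : Matrix (Fin N) (Fin N) ℝ) (i j : Fin N) :
    ((planeRotation a b hab θ : Matrix (Fin N) (Fin N) ℝ) * M) i j =
      if i = a then Real.cos θ * M a j - Real.sin θ * M b j
      else if i = b then Real.sin θ * M a j + Real.cos θ * M b j else M i j := by
  simp only [planeRotation, add_mul, sub_mul, one_mul, smul_mul_assoc, Matrix.add_apply,
    Matrix.sub_apply, Matrix.smul_apply, smul_eq_mul]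
  by_cases h1 : i = a
  · subst h1; simp [hab]; ring
  · by_cases h2 : i = b
    · subst h2; simp [h1]; ring
    · simp [h1, h2]

/-- The reflection that negates the coordinate `a`. -/
noncomputable def signFlip {N : ℕ} (a : Fin N) : Matrix.orthogonalGroup (Fin N) ℝ :=
  ⟨Matrix.diagonal fun i => if i = a then -1 else 1, by
    rw [Matrix.mem_orthogonalGroup_iff, Matrix.diagonal_transpose, Matrix.diagonal_mul_diagonal, ← Matrix.diagonal_one]
    congr 1; funext i; split_ifs <;> simp⟩

theorem orthogonal_column_dot {N : ℕ} (Q : Matrix.orthogonalGroup (Fin N) ℝ) (i j : Fin N) :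
    ∑ l, Q.1 l i * Q.1 l j = if i = j then 1 else 0 := by
  have h := (Matrix.mem_orthogonalGroup_iff' (Fin N) ℝ).mp Q.2
  have := congrFun (congrFun h i) j
  simpa [Matrix.mul_apply, Matrix.one_apply, Matrix.star_eq_conjTranspose] using this

theorem orthogonal_row_dot {N : ℕ} (Q : Matrix.orthogonalGroup (Fin N) ℝ) (i j : Fin N) :
    ∑ l, Q.1 i l * Q.1 j l = if i = j then 1 else 0 := by
  have h := (Matrix.mem_orthogonalGroup_iff (Fin N) ℝ).mp Q.2
  have := congrFun (congrFun h i) j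
  simpa [Matrix.mul_apply, Matrix.one_apply, Matrix.star_eq_conjTranspose] using this

section Generation

variable {N : ℕ} {H : Subgroup (Matrix.orthogonalGroup (Fin N) ℝ)}

/-- The first `k` columns of `Q` are those of the identity matrix. -/
def FixesBelow (k : ℕ) (Q : Matrix.orthogonalGroup (Fin N) ℝ) : Prop :=
  ∀ i j : Fin N, j.val < k → Q.1 i j = (1 : Matrix (Fin N) (Fin N) ℝ) i j

theorem FixesBelow.planeRotation_mul {k : ℕ} {Q : Matrix.orthogonalGroup (Fin N) ℝ}
    (hQ : FixesBelow k Q) {a b : Fin N} (hab : a ≠ b) (ha : k ≤ a.val) (hb : k ≤ b.val) (θ : ℝ) :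
    FixesBelow k (planeRotation a b hab θ * Q) := by
  intro i j hj
  rw [Submonoid.coe_mul, planeRotation_mul_apply, hQ a j hj, hQ b j hj, hQ i j hj,
    Matrix.one_apply_ne (fun h => by rw [h] at ha; omega),
    Matrix.one_apply_ne (fun h => by rw [h] at hb; omega)]
  split_ifs with h1 h2
  · subst h1; rw [Matrix.one_apply_ne (fun h => by rw [h] at ha; omega)]; simp
  · subst h2; rw [Matrix.one_apply_ne (fun h => by rw [h] at hb; omega)]; simp
  · rfl

/-- Gaussian elimination in column `k` by rotations in adjacent planes, from the bottom up. -/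
theorem exists_mul_column_eq_zero
    (hrot : ∀ (a b : Fin N) (hab : a ≠ b) (θ : ℝ), b.val = a.val + 1 → planeRotation a b hab θ ∈ H)
    (k : Fin N) {Q : Matrix.orthogonalGroup (Fin N) ℝ} (hQ : FixesBelow k Q) (d : ℕ) :
    ∃ h ∈ H, FixesBelow k (h * Q) ∧
      ∀ i : Fin N, k.val < i.val → N ≤ i.val + d → (h * Q).1 i k = 0 := by
  induction d with
  | zero => exact ⟨1, H.one_mem, by simpa using hQ, fun i _ hi => by have := i.2; omega⟩
  | succ d ih =>
    obtain ⟨h, hh, h1, h2⟩ := ih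
    by_cases hd : k.val + d + 1 < N
    · let b : Fin N := ⟨N - d - 1, by omega⟩
      let a : Fin N := ⟨N - d - 2, by omega⟩
      have hab : a ≠ b := fun e => by
        have := congrArg Fin.val e
        simp only [a, b] at this; omega
      have hka : k.val ≤ a.val := by simp only [a]; omega
      have hkb : k.val ≤ b.val := by simp only [b]; omega
      let z : ℂ := ⟨(h * Q).1 a k, (h * Q).1 b k⟩
      have hc : ‖z‖ * Real.cos z.arg = (h * Q).1 a k := Complex.norm_mul_cos_arg z
      have hs : ‖z‖ * Real.sin z.arg = (h * Q).1 b k := Complex.norm_mul_sin_arg z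
      refine ⟨planeRotation a b hab (-z.arg) * h, H.mul_mem (hrot a b hab _ ?_) hh, ?_, ?_⟩
      · simp only [a, b]; omega
      · rw [mul_assoc]; exact h1.planeRotation_mul hab hka hkb _
      · intro i hki hi
        rw [mul_assoc, Submonoid.coe_mul, planeRotation_mul_apply]
        have hia : i ≠ a := fun e => by
          rw [e] at hi; simp only [a] at hi; omega
        rw [if_neg hia]
        split_ifs with hib
        · rw [← hc, ← hs, Real.sin_neg, Real.cos_neg]; ring
        · refine h2 i hki ?_
          have : i.val ≠ b.val := fun e => hib (Fin.ext e)
          simp only [b] at this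
          omega
    · exact ⟨h, hh, h1, fun i hki _ => h2 i hki (by omega)⟩

/-- After the elimination, orthogonality of the columns leaves only the diagonal entry `±1` in column
`k`; a rotation by `π`, or the reflection in the last column, makes it positive. -/
theorem exists_mul_fixesBelow_succ
    (hrot : ∀ (a b : Fin N) (hab : a ≠ b) (θ : ℝ), b.val = a.val + 1 → planeRotation a b hab θ ∈ H)
    (hflip : ∀ a : Fin N, a.val + 1 = N → signFlip a ∈ H)
    (k : Fin N) {Q : Matrix.orthogonalGroup (Fin N) ℝ} (hQ : FixesBelow k Q) :
    ∃ h ∈ H, FixesBelow (k.val + 1) (h * Q) := by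
  obtain ⟨h, hh, h1, h2⟩ := exists_mul_column_eq_zero hrot k hQ N
  have hoff : ∀ i, i ≠ k → (h * Q).1 i k = 0 := by
    intro i hi
    rcases lt_or_gt_of_ne hi with hlt | hgt
    · have := orthogonal_column_dot (h * Q) i k
      rw [if_neg hi, Finset.sum_eq_single i] at this
      · rwa [h1 i i hlt, Matrix.one_apply_eq, one_mul] at this
      · intro l _ hl; rw [h1 l i hlt, Matrix.one_apply_ne hl, zero_mul]
      · simp
    · exact h2 i hgt (by omega)
  have hdiag : (h * Q).1 k k = 1 ∨ (h * Q).1 k k = -1 := by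
    have := orthogonal_column_dot (h * Q) k k
    rw [if_pos rfl, Finset.sum_eq_single k (fun l _ hl => by rw [hoff l hl, zero_mul])
      (by simp)] at this
    exact mul_self_eq_one_iff.mp this
  -- it suffices to repair the sign of the diagonal entry
  have hfin : ∀ R : Matrix.orthogonalGroup (Fin N) ℝ, FixesBelow k R → (∀ i, i ≠ k → R.1 i k = 0) →
      R.1 k k = 1 → FixesBelow (k.val + 1) R := by
    intro R hR h3 h4 i j hj
    rcases Nat.lt_succ_iff_lt_or_eq.mp hj with hlt | heq
    · exact hR i j hlt
    · obtain rfl : j = k := Fin.ext heq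
      by_cases hi : i = j
      · rw [hi, h4, Matrix.one_apply_eq]
      · rw [h3 i hi, Matrix.one_apply_ne hi]
  rcases hdiag with hd | hd
  · exact ⟨h, hh, hfin _ h1 hoff hd⟩
  · by_cases hk : k.val + 1 = N
    · refine ⟨signFlip k * h, H.mul_mem (hflip k hk) hh, ?_⟩
      rw [mul_assoc]
      have key : ∀ i j, (signFlip k * (h * Q)).1 i j =
          (if i = k then -1 else 1) * (h * Q).1 i j := by
        intro i j
        rw [Submonoid.coe_mul, signFlip, Matrix.diagonal_mul]
      refine hfin _ ?_ (fun i hi => by rw [key, hoff i hi, mul_zero]) (by rw [key, hd]; simp)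
      intro i j hj
      rw [key, h1 i j hj]
      by_cases hi : i = k
      · subst hi; rw [Matrix.one_apply_ne (fun e => by rw [e] at hj; omega)]; simp
      · simp [hi]
    · let b : Fin N := ⟨k.val + 1, by have := k.2; omega⟩
      have hkb : k ≠ b := fun e => by
        have := congrArg Fin.val e
        simp only [b] at this; omega
      refine ⟨planeRotation k b hkb Real.pi * h, H.mul_mem (hrot k b hkb _ rfl) hh, ?_⟩
      rw [mul_assoc]
      refine hfin _ (h1.planeRotation_mul hkb le_rfl (by simp [b]) _) (fun i hi => ?_) ?_
      · rw [Submonoid.coe_mul, planeRotation_mul_apply, if_neg hi]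
        split_ifs with hib
        · rw [hoff b hkb.symm]; simp
        · exact hoff i hi
      · rw [Submonoid.coe_mul, planeRotation_mul_apply, if_pos rfl, hd]; simp

theorem eq_top_of_planeRotation_mem_of_signFlip_mem
    (hrot : ∀ (a b : Fin N) (hab : a ≠ b) (θ : ℝ), b.val = a.val + 1 → planeRotation a b hab θ ∈ H)
    (hflip : ∀ a : Fin N, a.val + 1 = N → signFlip a ∈ H) : H = ⊤ := by
  have key : ∀ (d k : ℕ) (Q : Matrix.orthogonalGroup (Fin N) ℝ), k + d = N → FixesBelow k Q →
      Q ∈ H := by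
    intro d
    induction d with
    | zero =>
      intro k Q hk hQ
      have : Q = 1 := Subtype.ext (Matrix.ext fun i j => hQ i j (by have := j.2; omega))
      rw [this]; exact H.one_mem
    | succ d ih =>
      intro k Q hk hQ
      obtain ⟨h, hh, h1⟩ := exists_mul_fixesBelow_succ hrot hflip ⟨k, by omega⟩ hQ
      exact (Subgroup.mul_mem_cancel_left H hh).mp (ih (k + 1) _ (by omega) h1)
  exact (Subgroup.eq_top_iff' H).mpr fun Q => key N 0 Q (by omega) (fun i j hj => by omega)

end Generation

/-! ### Every orthogonal matrix is implemented by a generalized matchgate -/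

theorem exp_smul_of_mul_self_eq_neg_one {ι : Type*} [Fintype ι] [DecidableEq ι]
    {K : Matrix ι ι ℂ} (hK : K * K = -1) (α : ℝ) :
    NormedSpace.exp ((α : ℂ) • K) = (Real.cos α : ℂ) • 1 + (Real.sin α : ℂ) • K := by
  let _ : NormedRing (Matrix ι ι ℂ) := Matrix.linftyOpNormedRing
  let _ : NormedAlgebra ℂ (Matrix ι ι ℂ) := Matrix.linftyOpNormedAlgebra
  let _ : NormedAlgebra ℝ (Matrix ι ι ℂ) := Matrix.linftyOpNormedAlgebra
  -- `i ↦ K` extends to an algebra homomorphism `ℂ → Matrix ι ι ℂ`, which commutes with `exp`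
  let f : ℂ →ₐ[ℝ] Matrix ι ι ℂ := Complex.liftAux K hK
  have hf : ∀ z : ℂ, f z = (z.re : ℂ) • (1 : Matrix ι ι ℂ) + (z.im : ℂ) • K := by
    intro z
    simp only [f, Complex.liftAux_apply, Algebra.algebraMap_eq_smul_one]
    congr 1
  have hcont : Continuous f := f.toLinearMap.continuous_of_finiteDimensional
  have h := NormedSpace.map_exp (f : ℂ →+* Matrix ι ι ℂ) hcont (α * Complex.I)
  have h2 : (f : ℂ →+* Matrix ι ι ℂ) (α * Complex.I) = (α : ℂ) • K := by
    have := hf (α * Complex.I)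
    simpa using this
  rw [h2] at h
  refine h.symm.trans ?_
  rw [← Complex.exp_eq_exp_ℂ]
  have := hf (Complex.exp (α * Complex.I))
  rw [Complex.exp_ofReal_mul_I_re, Complex.exp_ofReal_mul_I_im] at this
  exact this

section Gate

variable {n : ℕ} {a b : Fin (2 * n)}

theorem majorana_pair_mul_self (hab : a ≠ b) :
    ((majorana a : Op n) * majorana b) * (majorana a * majorana b) = -1 := by
  rw [mul_assoc, ← mul_assoc (majorana b), majorana_anticomm hab.symm, neg_mul, mul_neg, mul_assoc,
    majorana_mul_self, mul_one, majorana_mul_self]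

/-- The gate `exp(α γ_a γ_b)`. -/
noncomputable def pairGate (a b : Fin (2 * n)) (α : ℝ) : Op n :=
  (Real.cos α : ℂ) • 1 + (Real.sin α : ℂ) • (majorana a * majorana b)

theorem pairGate_conjTranspose (hab : a ≠ b) (α : ℝ) :
    (pairGate a b α)ᴴ = pairGate a b (-α) := by
  simp only [pairGate, Matrix.conjTranspose_add, Matrix.conjTranspose_smul,
    Matrix.conjTranspose_mul, majorana_conjTranspose, majorana_anticomm hab.symm,
    Matrix.conjTranspose_one, Real.cos_neg, Real.sin_neg, Complex.ofReal_neg, smul_neg, neg_smul,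
    Complex.star_def, Complex.conj_ofReal]

theorem pairGate_mul (hab : a ≠ b) (α β : ℝ) :
    pairGate a b α * pairGate a b β = pairGate a b (α + β) := by
  simp only [pairGate, add_mul, mul_add, smul_mul_smul_comm, one_mul, mul_one,
    majorana_pair_mul_self hab, Real.cos_add, Real.sin_add, Complex.ofReal_sub, Complex.ofReal_add,
    Complex.ofReal_mul]
  module

theorem pairGate_mem_unitaryGroup (hab : a ≠ b) (α : ℝ) :
    pairGate a b α ∈ Matrix.unitaryGroup (Bits n) ℂ := by
  rw [Matrix.mem_unitaryGroup_iff, Matrix.star_eq_conjTranspose, pairGate_conjTranspose hab,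
    pairGate_mul hab, add_neg_cancel]
  simp [pairGate]

/-- Conjugation by `exp(α γ_a γ_b)` rotates the plane of `γ_a` and `γ_b` by the angle `-2α`. -/
theorem pairGate_conj_majorana (hab : a ≠ b) (α : ℝ) (s : Fin (2 * n)) :
    pairGate a b α * majorana s * pairGate a b (-α) =
      if s = a then (Real.cos (-(2 * α)) : ℂ) • majorana a + (Real.sin (-(2 * α)) : ℂ) • majorana b
      else if s = b then
        -((Real.sin (-(2 * α)) : ℂ) • majorana a) + (Real.cos (-(2 * α)) : ℂ) • majorana b
      else majorana s := by
  have hsign : ∀ β : ℝ, pairGate a b β * majorana s =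
      majorana s * pairGate a b (if s = a ∨ s = b then -β else β) := by
    intro β
    have h1 : (majorana a * majorana b) * majorana s = (if s = a ∨ s = b then -1 else 1 : ℂ) •
        ((majorana s : Op n) * (majorana a * majorana b)) := by
      by_cases h2 : s = a
      · subst h2
        rw [mul_assoc, majorana_anticomm hab.symm]; simp
      · by_cases h3 : s = b
        · subst h3
          rw [majorana_anticomm hab, ← mul_neg, mul_assoc, neg_mul,
            majorana_anticomm hab]; simp
        · rw [mul_assoc, majorana_anticomm (Ne.symm h3), mul_neg, ← mul_assoc,
            majorana_anticomm (Ne.symm h2)]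
          simp [h2, h3, mul_assoc]
    simp only [pairGate, add_mul, mul_add, smul_mul_assoc, mul_smul_comm, h1, one_mul, mul_one,
      smul_smul]
    split_ifs <;> simp
  rw [hsign, mul_assoc, pairGate_mul hab]
  by_cases h2 : s = a
  · subst h2
    simp only [true_or, if_true, ← two_mul, mul_neg, pairGate, mul_add, mul_smul_comm, mul_one,
      ← mul_assoc, majorana_mul_self, one_mul]
  · by_cases h3 : s = b
    · subst h3
      simp only [or_true, if_true, h2, if_false, pairGate, mul_add, mul_smul_comm, mul_one]
      rw [majorana_anticomm hab, mul_neg, ← mul_assoc, majorana_mul_self, one_mul, two_mul, neg_add,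
        smul_neg, add_comm]
    · simp [h2, h3, pairGate]

theorem pairGate_mem_genMatchgateGroup (hb : b.val = a.val + 1) (hab : a ≠ b) (α : ℝ) :
    (⟨pairGate a b α, pairGate_mem_unitaryGroup hab α⟩ : Matrix.unitaryGroup (Bits n) ℂ) ∈
      genMatchgateGroup n := by
  have hexp := exp_smul_of_mul_self_eq_neg_one (majorana_pair_mul_self (n := n) hab) α
  have ha' := a.2
  have hb' := b.2
  refine (le_sup_left : matchgateGroup n ≤ _) (Subgroup.subset_closure ?_)
  by_cases hpar : a.val % 2 = 0
  · right
    refine ⟨⟨a.val / 2, by omega⟩, α, ?_⟩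
    change pairGate a b α = _
    rw [pairGate, ← hexp, majorana_mul_majorana_eq_pauliZ ⟨a.val / 2, by omega⟩ (by simp; omega)
      (by simp; omega), smul_smul, mul_comm (α : ℂ)]
  · left
    refine ⟨⟨a.val / 2, by omega⟩, ⟨a.val / 2 + 1, by omega⟩, rfl, pauliX, by simp, pauliX,
      by simp, α, ?_⟩
    change pairGate a b α = _
    rw [pairGate, ← hexp, majorana_mul_majorana_eq_pauliX (i := ⟨a.val / 2, by omega⟩)
      (j := ⟨a.val / 2 + 1, by omega⟩) rfl (by simp; omega)
      (by simp; omega), smul_smul, mul_comm (α : ℂ)]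

end Gate

/-- The subgroup of orthogonal matrices that are implemented by some generalized matchgate. -/
def implementable (n : ℕ) : Subgroup (Matrix.orthogonalGroup (Fin (2 * n)) ℝ) where
  carrier := {Q | ∃ U ∈ genMatchgateGroup n, Implements U Q}
  one_mem' := ⟨1, Subgroup.one_mem _, fun j => by simp [Matrix.one_apply]⟩
  mul_mem' := by
    rintro Q R ⟨U, hU, hQ⟩ ⟨V, hV, hR⟩
    refine ⟨U * V, Subgroup.mul_mem _ hU hV, fun j => ?_⟩
    have : ((U * V : Matrix.unitaryGroup (Bits n) ℂ) : Op n) * majorana j *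
        ((U * V : Matrix.unitaryGroup (Bits n) ℂ) : Op n)ᴴ =
        (U : Op n) * ((V : Op n) * majorana j * (V : Op n)ᴴ) * (U : Op n)ᴴ := by
      simp only [Submonoid.coe_mul, Matrix.conjTranspose_mul, mul_assoc]
    rw [this, hR j, Finset.mul_sum, Finset.sum_mul]
    simp only [mul_smul_comm, smul_mul_assoc, hQ _, Finset.smul_sum, smul_smul]
    rw [Finset.sum_comm]
    refine Finset.sum_congr rfl fun k _ => ?_
    rw [← Finset.sum_smul, Submonoid.coe_mul, Matrix.mul_apply, Complex.ofReal_sum]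
    congr 1
    exact Finset.sum_congr rfl fun l _ => by rw [Complex.ofReal_mul, mul_comm]
  inv_mem' := by
    rintro Q ⟨U, hU, hQ⟩
    refine ⟨U⁻¹, Subgroup.inv_mem _ hU, fun k => ?_⟩
    have h1 : ∑ j, ((Q.1 k j : ℝ) : ℂ) • ((U : Op n) * majorana j * (U : Op n)ᴴ) = majorana k := by
      simp only [hQ _, Finset.smul_sum, smul_smul]
      rw [Finset.sum_comm]
      simp only [← Finset.sum_smul, ← Complex.ofReal_mul, ← Complex.ofReal_sum]
      have := fun l => orthogonal_row_dot Q k l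
      simp [this]
    have hU1 : (U : Op n)ᴴ * (U : Op n) = 1 := Matrix.mem_unitaryGroup_iff'.mp U.2
    have hinv : ((U⁻¹ : Matrix.unitaryGroup (Bits n) ℂ) : Op n) = (U : Op n)ᴴ := rfl
    rw [hinv, Matrix.conjTranspose_conjTranspose, ← h1, Finset.mul_sum, Finset.sum_mul]
    refine Finset.sum_congr rfl fun j _ => ?_
    rw [mul_smul_comm, smul_mul_assoc]
    congr 1
    rw [← mul_assoc, ← mul_assoc, hU1, one_mul, mul_assoc, hU1, mul_one]

theorem implementable_eq_top (n : ℕ) : implementable n = ⊤ := by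
  refine eq_top_of_planeRotation_mem_of_signFlip_mem ?_ ?_
  · intro a b hab θ hb
    refine ⟨_, pairGate_mem_genMatchgateGroup hb hab (-(θ / 2)), fun j => ?_⟩
    have e : -(2 * -(θ / 2)) = θ := by ring
    have h := fun k => planeRotation_mul_apply a b hab θ 1 k j
    simp only [mul_one] at h
    simp only [pairGate_conjTranspose hab, pairGate_conj_majorana hab, e, h]
    have hs : ∀ k, ((((if k = a then Real.cos θ * (1 : Matrix _ _ ℝ) a j -
        Real.sin θ * (1 : Matrix _ _ ℝ) b j else if k = b then
        Real.sin θ * (1 : Matrix _ _ ℝ) a j + Real.cos θ * (1 : Matrix _ _ ℝ) b j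
        else (1 : Matrix _ _ ℝ) k j : ℝ)) : ℂ) • (majorana k : Op n)) =
        (if k = a then (((Real.cos θ - 1) * (1 : Matrix _ _ ℝ) a j -
          Real.sin θ * (1 : Matrix _ _ ℝ) b j : ℝ) : ℂ) • (majorana a : Op n) else 0) +
        (if k = b then ((Real.sin θ * (1 : Matrix _ _ ℝ) a j +
          (Real.cos θ - 1) * (1 : Matrix _ _ ℝ) b j : ℝ) : ℂ) • (majorana b : Op n) else 0) +
        (if k = j then (majorana j : Op n) else 0) := by
      intro k
      by_cases h1 : k = a
      · subst h1
        by_cases h3 : k = j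
        · subst h3; simp [hab, hab.symm, sub_smul]
        · simp [hab, h3]
      · by_cases h2 : k = b
        · subst h2
          by_cases h3 : k = j
          · subst h3; simp [hab, hab.symm, sub_smul]
          · simp [hab.symm, h3]
        · by_cases h3 : k = j
          · subst h3; simp [h1, h2]
          · simp [h1, h2, h3]
    simp only [hs, Finset.sum_add_distrib, Finset.sum_ite_eq', Finset.mem_univ, if_true]
    by_cases h1 : j = a
    · subst h1
      simp [Matrix.one_apply_ne hab.symm, sub_smul]; abel
    · by_cases h2 : j = b
      · subst h2; simp [Matrix.one_apply_ne hab, sub_smul, hab.symm]; abel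
      · simp [Matrix.one_apply_ne (Ne.symm h1), Matrix.one_apply_ne (Ne.symm h2), h1, h2]
  · intro a ha
    have hn : 0 < n := by have := a.2; omega
    let j : Fin n := ⟨n - 1, by omega⟩
    have hj : j.val + 1 = n := by simp only [j]; omega
    have hH : (onQubit j pauliX)ᴴ = onQubit j pauliX := by
      rw [onQubit_conjTranspose, pauliX_conjTranspose]
    refine ⟨⟨onQubit j pauliX, ?_⟩, ?_, fun s => ?_⟩
    · rw [Matrix.mem_unitaryGroup_iff, Matrix.star_eq_conjTranspose, hH,
        onQubit_mul_self j pauliX_mul_self]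
    · exact (le_sup_right : _ ≤ genMatchgateGroup n) (Subgroup.subset_closure ⟨j, hj, rfl⟩)
    · have hiff : s = a ↔ s.val + 1 = 2 * n :=
        ⟨fun h => h ▸ ha, fun h => Fin.ext (by omega)⟩
      simp only [hH, onQubit_last_conj_majorana hj, signFlip, Matrix.diagonal_apply, ← hiff]
      rw [Finset.sum_eq_single s (fun k _ hk => by simp [hk]) (by simp), if_pos rfl]
      split_ifs <;> simp

theorem genMatchgate_implements {n : ℕ} (Q : Matrix.orthogonalGroup (Fin (2 * n)) ℝ) :
    Implements (genMatchgate Q) Q := by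
  have h : Q ∈ implementable n := by rw [implementable_eq_top]; trivial
  exact (Classical.epsilon_spec (p := fun U => U ∈ genMatchgateGroup n ∧ Implements U Q) h).2

/-! ### The action of the orthogonal group on operators -/

section Omega

variable {n : ℕ}

theorem omega_apply (Q : Matrix.orthogonalGroup (Fin (2 * n)) ℝ) (A : Op n) :
    omega Q A = (genMatchgate Q : Op n) * A * (genMatchgate Q : Op n)ᴴ := by
  simp [omega, mul_assoc]

theorem genMatchgate_conjTranspose_mul (Q : Matrix.orthogonalGroup (Fin (2 * n)) ℝ) :
    (genMatchgate Q : Op n)ᴴ * (genMatchgate Q : Op n) = 1 :=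
  Matrix.mem_unitaryGroup_iff'.mp (genMatchgate Q).2

theorem trace_omega (Q : Matrix.orthogonalGroup (Fin (2 * n)) ℝ) (A : Op n) :
    (omega Q A).trace = A.trace := by
  rw [omega_apply, Matrix.trace_mul_comm, ← mul_assoc, genMatchgate_conjTranspose_mul, one_mul]

/-- Conjugation by `U(Q)`, as an algebra homomorphism. -/
noncomputable def omegaHom (Q : Matrix.orthogonalGroup (Fin (2 * n)) ℝ) : Op n →ₐ[ℂ] Op n :=
  AlgHom.ofLinearMap (omega Q)
    (by rw [omega_apply, mul_one]; exact Matrix.mem_unitaryGroup_iff.mp (genMatchgate Q).2)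
    (fun A B => by
      simp only [omega_apply, mul_assoc]
      rw [← mul_assoc _ (genMatchgate Q : Op n), genMatchgate_conjTranspose_mul, one_mul])

theorem omegaHom_apply (Q : Matrix.orthogonalGroup (Fin (2 * n)) ℝ) (A : Op n) :
    omegaHom Q A = omega Q A := rfl

theorem omega_mul_op (Q : Matrix.orthogonalGroup (Fin (2 * n)) ℝ) (A B : Op n) :
    omega Q (A * B) = omega Q A * omega Q B := map_mul (omegaHom Q) A B

theorem omega_majorana (Q : Matrix.orthogonalGroup (Fin (2 * n)) ℝ) (j : Fin (2 * n)) :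
    omega Q (majorana j) = ∑ k, ((Q.1 k j : ℝ) : ℂ) • (majorana k : Op n) := by
  rw [omega_apply]; exact genMatchgate_implements Q j

theorem omega_listProd (Q : Matrix.orthogonalGroup (Fin (2 * n)) ℝ) (l : List (Fin (2 * n))) :
    omega Q (listProd l) =
      (l.map fun j => ∑ k, ((Q.1 k j : ℝ) : ℂ) • (majorana k : Op n)).prod := by
  rw [← omegaHom_apply, listProd, map_list_prod, List.map_map]
  congr 2
  funext j
  exact omega_majorana Q j

theorem algHom_ext_majorana {f g : Op n →ₐ[ℂ] Op n} (h : ∀ j, f (majorana j) = g (majorana j)) :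
    f = g := by
  have : f.toLinearMap = g.toLinearMap := by
    refine (majoranaBasis n).ext fun S => ?_
    simp only [majoranaBasis_apply, majoranaProd, AlgHom.toLinearMap_apply, map_list_prod,
      List.map_map]
    congr 2
    funext j
    exact h j
  exact AlgHom.toLinearMap_injective this

theorem omega_mul (Q R : Matrix.orthogonalGroup (Fin (2 * n)) ℝ) (A : Op n) :
    omega (Q * R) A = omega Q (omega R A) := by
  have : omegaHom (n := n) (Q * R) = (omegaHom Q).comp (omegaHom R) := by
    refine algHom_ext_majorana fun j => ?_
    rw [AlgHom.comp_apply]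
    simp only [omegaHom_apply, omega_majorana, map_sum, map_smul, Finset.smul_sum, smul_smul]
    rw [Finset.sum_comm]
    refine Finset.sum_congr rfl fun k _ => ?_
    rw [← Finset.sum_smul, Submonoid.coe_mul, Matrix.mul_apply, Complex.ofReal_sum]
    congr 1
    exact Finset.sum_congr rfl fun l _ => by rw [Complex.ofReal_mul, mul_comm]
  exact DFunLike.congr_fun this A

theorem omega_one (A : Op n) : omega (1 : Matrix.orthogonalGroup (Fin (2 * n)) ℝ) A = A := by
  have : omegaHom (n := n) 1 = AlgHom.id ℂ (Op n) := by
    refine algHom_ext_majorana fun j => ?_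
    rw [omegaHom_apply, omega_majorana]
    simp [Matrix.one_apply]
  exact DFunLike.congr_fun this A

/-! ### The degree is preserved -/

/-- The superoperator `A ↦ ∑_j γ_j A γ_j`. It commutes with every `ω(Q)`, and its eigenvalues
tell apart the spans of the `γ[S]` with `|S| = k`. -/
noncomputable def casimir (A : Op n) : Op n := ∑ j, majorana j * A * majorana j

theorem omega_casimir (Q : Matrix.orthogonalGroup (Fin (2 * n)) ℝ) (A : Op n) :
    omega Q (casimir A) = casimir (omega Q A) := by
  have h : ∀ k l, ∑ j, (((Q.1 k j : ℝ) : ℂ) * ((Q.1 l j : ℝ) : ℂ)) = if k = l then 1 else 0 := by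
    intro k l
    have := orthogonal_row_dot Q k l
    rw [← Complex.ofReal_one, ← Complex.ofReal_zero, ← apply_ite Complex.ofReal, ← this]
    push_cast; rfl
  have h1 : omega Q (casimir A) = ∑ j, ∑ k, ∑ l, (((Q.1 k j : ℝ) : ℂ) * ((Q.1 l j : ℝ) : ℂ)) •
      (majorana k * omega Q A * majorana l) := by
    simp only [casimir, map_sum, omega_mul_op, omega_majorana, Finset.sum_mul, Finset.mul_sum,
      smul_mul_assoc, mul_smul_comm, Finset.smul_sum, smul_smul]
    refine Finset.sum_congr rfl fun j _ => ?_
    rw [Finset.sum_comm]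
    simp only [mul_comm]
  rw [h1, Finset.sum_comm]
  refine Finset.sum_congr rfl fun k _ => ?_
  rw [Finset.sum_comm]
  simp [← Finset.sum_smul, h]

theorem casimir_majoranaProd (S : Finset (Fin (2 * n))) :
    casimir (majoranaProd S) =
      ((-1 : ℂ) ^ S.card * (2 * n - 2 * S.card)) • (majoranaProd S : Op n) := by
  simp only [casimir, majorana_conj_majoranaProd, ← Finset.sum_smul, conjSign, ← Finset.mul_sum]
  congr 2
  have : ∀ j : Fin (2 * n), (if j ∈ S then (-1 : ℂ) else 1) = 1 - 2 * if j ∈ S then 1 else 0 := by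
    intro j; split_ifs <;> norm_num
  simp only [this, Finset.sum_sub_distrib, ← Finset.mul_sum]
  simp

/-- The absolute value of the eigenvalue determines `k` up to `k ↔ 2n - k`, and these two degrees have
eigenvalues of opposite signs. -/
theorem casimir_eigenvalue_injective {k l : ℕ} (hk : k ≤ 2 * n) (hl : l ≤ 2 * n)
    (h : (-1 : ℂ) ^ k * (2 * n - 2 * k) = (-1) ^ l * (2 * n - 2 * l)) : k = l := by
  have hz : (-1 : ℤ) ^ k * (2 * n - 2 * k) = (-1) ^ l * (2 * n - 2 * l) := by exact_mod_cast h
  rcases Nat.even_or_odd k with h1 | h1 <;> rcases Nat.even_or_odd l with h2 | h2 <;>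
    simp only [h1.neg_one_pow, h2.neg_one_pow] at hz
  · omega
  · exfalso
    obtain ⟨a, rfl⟩ := h1
    obtain ⟨b, rfl⟩ := h2
    omega
  · exfalso
    obtain ⟨a, rfl⟩ := h1
    obtain ⟨b, rfl⟩ := h2
    omega
  · omega

/-- The matrix entries of `ω(Q)` in the basis of the `γ[S]`. -/
noncomputable def omegaCoeff (Q : Matrix.orthogonalGroup (Fin (2 * n)) ℝ)
    (T S : Finset (Fin (2 * n))) : ℂ := coeff T (omega Q (majoranaProd S))

/-- `ω(Q)` preserves the degree. -/
theorem omegaCoeff_eq_zero (Q : Matrix.orthogonalGroup (Fin (2 * n)) ℝ)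
    {T S : Finset (Fin (2 * n))} (h : T.card ≠ S.card) : omegaCoeff Q T S = 0 := by
  have hcas : ∀ A : Op n, coeff T (casimir A) =
      ((-1 : ℂ) ^ T.card * (2 * n - 2 * T.card)) * coeff T A := by
    intro A
    conv_lhs => rw [← sum_coeff_smul A]
    have : casimir (∑ S, coeff S A • majoranaProd S) =
        ∑ S, coeff S A • casimir (majoranaProd S : Op n) := by
      simp only [casimir, Finset.mul_sum, Finset.sum_mul, Finset.smul_sum, mul_smul_comm,
        smul_mul_assoc]
      exact Finset.sum_comm
    rw [this]
    simp [casimir_majoranaProd, coeff_majoranaProd]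
    ring
  have h1 := hcas (omega Q (majoranaProd S))
  rw [← omega_casimir, casimir_majoranaProd, map_smul, map_smul, smul_eq_mul] at h1
  by_contra hne
  have h2 := mul_right_cancel₀ hne h1
  have hS := S.card_le_univ
  have hT := T.card_le_univ
  rw [Fintype.card_fin] at hS hT
  exact h (casimir_eigenvalue_injective hS hT h2).symm

theorem omega_majoranaProd (Q : Matrix.orthogonalGroup (Fin (2 * n)) ℝ)
    (S : Finset (Fin (2 * n))) :
    omega Q (majoranaProd S) = ∑ T, omegaCoeff Q T S • majoranaProd T :=
  (sum_coeff_smul _).symm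

theorem sum_omegaCoeff_sq (Q : Matrix.orthogonalGroup (Fin (2 * n)) ℝ)
    (S : Finset (Fin (2 * n))) : ∑ T, omegaCoeff Q T S * omegaCoeff Q T S = 1 := by
  -- compare the traces of `γ[S]²` and of `ω(Q)(γ[S])²`
  have h1 : (omega Q (majoranaProd S) * omega Q (majoranaProd S)).trace =
      reversalSign S.card * 2 ^ n := by
    rw [← omega_mul_op, trace_omega, trace_majoranaProd_mul', if_pos rfl]
  rw [omega_majoranaProd] at h1
  simp only [Finset.sum_mul, Finset.mul_sum, Matrix.trace_sum, smul_mul_smul_comm,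
    Matrix.trace_smul, trace_majoranaProd_mul', smul_eq_mul, mul_ite, mul_zero,
    Finset.sum_ite_eq', Finset.mem_univ, if_true] at h1
  have h2 : ∀ T : Finset (Fin (2 * n)), omegaCoeff Q T S * omegaCoeff Q T S *
      (reversalSign T.card * 2 ^ n) =
      (omegaCoeff Q T S * omegaCoeff Q T S) * (reversalSign S.card * 2 ^ n) := by
    intro T
    by_cases h : T.card = S.card
    · rw [h]
    · simp [omegaCoeff_eq_zero Q h]
  simp only [h2, ← Finset.sum_mul] at h1
  exact mul_right_cancel₀ (mul_ne_zero (reversalSign_ne_zero _) (by positivity))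
    (h1.trans (one_mul _).symm)

theorem omegaCoeff_mul (Q R : Matrix.orthogonalGroup (Fin (2 * n)) ℝ)
    (T S : Finset (Fin (2 * n))) :
    omegaCoeff (Q * R) T S = ∑ V, omegaCoeff Q T V * omegaCoeff R V S := by
  rw [omegaCoeff, omega_mul, omega_majoranaProd R]
  simp [omegaCoeff, mul_comm]

/-! ### Sign flips and permutations of the Majorana operators -/

theorem omega_signFlip_majoranaProd (a : Fin (2 * n)) (S : Finset (Fin (2 * n))) :
    omega (signFlip a) (majoranaProd S) =
      (if a ∈ S then (-1 : ℂ) else 1) • (majoranaProd S : Op n) := by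
  have h : ∀ l : List (Fin (2 * n)), l.Nodup → omega (signFlip a) (listProd l) =
      (if a ∈ l then (-1 : ℂ) else 1) • (listProd l : Op n) := by
    intro l hl
    induction l with
    | nil =>
      simp only [listProd_nil, List.not_mem_nil, if_false, one_smul]
      exact map_one (omegaHom (signFlip a))
    | cons b l ih =>
      obtain ⟨hb, hl⟩ := List.nodup_cons.mp hl
      have h1 : omega (signFlip a) (majorana b) = (if a = b then (-1 : ℂ) else 1) •
          (majorana b : Op n) := by
        rw [omega_majorana, Finset.sum_eq_single b]
        · simp [signFlip, eq_comm]
        · intro k _ hk; simp [signFlip, hk]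
        · simp
      rw [listProd_cons, omega_mul_op, ih hl, h1, smul_mul_smul_comm]
      congr 1
      by_cases h2 : a = b
      · subst h2; simp [hb]
      · simp [h2]
  rw [majoranaProd_eq_listProd, h _ (S.sort_nodup _)]
  simp

theorem omegaCoeff_signFlip_mul (a : Fin (2 * n)) (Q : Matrix.orthogonalGroup (Fin (2 * n)) ℝ)
    (T S : Finset (Fin (2 * n))) :
    omegaCoeff (signFlip a * Q) T S = (if a ∈ T then -1 else 1) * omegaCoeff Q T S := by
  rw [omegaCoeff_mul]
  simp only [omegaCoeff, omega_signFlip_majoranaProd, map_smul, coeff_majoranaProd, smul_eq_mul,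
    mul_ite, mul_one, mul_zero]
  simp

theorem omegaCoeff_mul_signFlip (a : Fin (2 * n)) (Q : Matrix.orthogonalGroup (Fin (2 * n)) ℝ)
    (T S : Finset (Fin (2 * n))) :
    omegaCoeff (Q * signFlip a) T S = (if a ∈ S then -1 else 1) * omegaCoeff Q T S := by
  rw [omegaCoeff, omega_mul, omega_signFlip_majoranaProd, map_smul, map_smul]
  rfl

/-- The permutation matrix that sends `e_j` to `e_{σ j}`. -/
def permOrthogonal {N : ℕ} (σ : Equiv.Perm (Fin N)) : Matrix.orthogonalGroup (Fin N) ℝ :=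
  ⟨(1 : Matrix (Fin N) (Fin N) ℝ).submatrix id σ, by
    rw [Matrix.mem_orthogonalGroup_iff, Matrix.transpose_submatrix, Matrix.submatrix_mul_equiv]
    simp⟩

theorem omega_permOrthogonal_majoranaProd (σ : Equiv.Perm (Fin (2 * n)))
    (S : Finset (Fin (2 * n))) :
    ∃ τ : ℂ, τ * τ = 1 ∧ omega (permOrthogonal σ) (majoranaProd S) =
      τ • (majoranaProd (S.map σ.toEmbedding) : Op n) := by
  have h1 : omega (permOrthogonal σ) (majoranaProd S) =
      (listProd ((S.sort (· ≤ ·)).map σ) : Op n) := by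
    rw [majoranaProd_eq_listProd, omega_listProd, listProd, List.map_map]
    congr 2
    funext j
    rw [Finset.sum_eq_single (σ j)]
    · simp [permOrthogonal, Matrix.submatrix_apply, Matrix.one_apply]
    · intro k _ hk; simp [permOrthogonal, Matrix.submatrix_apply, hk]
    · simp
  have hn : ((S.sort (· ≤ ·)).map σ).Nodup := (S.sort_nodup _).map σ.injective
  obtain ⟨τ, h2, h3⟩ := listProd_perm (n := n)
    ((List.perm_ext_iff_of_nodup hn ((S.map σ.toEmbedding).sort_nodup (· ≤ ·))).mpr
      (fun a => by
        rw [Finset.mem_sort, List.mem_map, Finset.mem_map]; simp only [Finset.mem_sort]; rfl)) hn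
  exact ⟨τ, h2, by rw [h1, h3, majoranaProd_eq_listProd]⟩

/-- Up to signs, which the square removes, a permutation matrix permutes the rows of `ω(Q)`. -/
theorem omegaCoeff_permOrthogonal_mul_sq (σ : Equiv.Perm (Fin (2 * n)))
    (Q : Matrix.orthogonalGroup (Fin (2 * n)) ℝ) (T S : Finset (Fin (2 * n))) :
    omegaCoeff (permOrthogonal σ * Q) (T.map σ.toEmbedding) S *
      omegaCoeff (permOrthogonal σ * Q) (T.map σ.toEmbedding) S =
      omegaCoeff Q T S * omegaCoeff Q T S := by
  have h : ∃ τ : ℂ, τ * τ = 1 ∧ omegaCoeff (permOrthogonal σ * Q) (T.map σ.toEmbedding) S =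
      τ * omegaCoeff Q T S := by
    obtain ⟨τ, h1, h2⟩ := omega_permOrthogonal_majoranaProd σ T
    refine ⟨τ, h1, ?_⟩
    rw [omegaCoeff_mul, Finset.sum_eq_single T]
    · rw [omegaCoeff, h2, map_smul, coeff_majoranaProd]; simp
    · intro V _ hV
      obtain ⟨τ', _, h4⟩ := omega_permOrthogonal_majoranaProd σ V
      rw [omegaCoeff, h4, map_smul, coeff_majoranaProd, if_neg]
      · simp
      · intro e; exact hV (Finset.map_injective _ e).symm
    · simp
  obtain ⟨τ, h1, h2⟩ := h
  rw [h2, mul_mul_mul_comm, h1, one_mul]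

theorem exists_perm_map_eq {α : Type*} [Fintype α] [DecidableEq α] {S T : Finset α}
    (h : S.card = T.card) : ∃ σ : Equiv.Perm α, S.map σ.toEmbedding = T := by
  let e : {x // x ∈ S} ≃ {x // x ∈ T} := Fintype.equivOfCardEq (by simpa using h)
  refine ⟨e.extendSubtype, ?_⟩
  refine Finset.eq_of_subset_of_card_le ?_ (by rw [Finset.card_map]; exact h.ge)
  intro x hx
  obtain ⟨y, hy, rfl⟩ := Finset.mem_map.mp hx
  exact Equiv.extendSubtype_mem e y hy

/-! ### Continuity -/

theorem continuous_orthogonal_entry (N : ℕ) (k j : Fin N) :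
    Continuous fun Q : Matrix.orthogonalGroup (Fin N) ℝ => Q.1 k j :=
  (continuous_apply_apply k j).comp continuous_subtype_val

theorem continuous_omega (A : Op n) :
    Continuous fun Q : Matrix.orthogonalGroup (Fin (2 * n)) ℝ => omega Q A := by
  have h : ∀ Q : Matrix.orthogonalGroup (Fin (2 * n)) ℝ, omega Q A = ∑ S, coeff S A •
      (((S.sort (· ≤ ·))).map fun j => ∑ k, ((Q.1 k j : ℝ) : ℂ) • (majorana k : Op n)).prod := by
    intro Q
    conv_lhs => rw [← sum_coeff_smul A]
    simp only [map_sum, map_smul, majoranaProd_eq_listProd, omega_listProd]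
  simp only [h]
  refine continuous_finsetSum _ fun S _ =>
    (continuous_const_smul (coeff S A)).comp ?_
  refine continuous_list_prod _ fun j _ => continuous_finsetSum _ fun k _ => ?_
  exact (Complex.continuous_ofReal.comp (continuous_orthogonal_entry _ k j)).smul continuous_const

theorem continuous_linearFunctional (a : Op n →ₗ[ℂ] ℂ) : Continuous a :=
  LinearMap.continuous_of_finiteDimensional a

theorem continuous_superOp (L : SuperOp n) : Continuous L :=
  LinearMap.continuous_of_finiteDimensional L

theorem continuous_omegaCoeff (T S : Finset (Fin (2 * n))) :
    Continuous fun Q : Matrix.orthogonalGroup (Fin (2 * n)) ℝ => omegaCoeff Q T S :=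
  (continuous_linearFunctional _).comp (continuous_omega _)

end Omega

/-! ### Haar averages of the matrix entries of `ω(Q)` -/

section Haar

variable {ι 𝕜 : Type*} [Fintype ι] [DecidableEq ι] [RCLike 𝕜]

instance instIsHaarMeasureHaarProb : (haarProb ι 𝕜).IsHaarMeasure :=
  Measure.isHaarMeasure_haarMeasure _

instance instIsProbabilityMeasureHaarProb : IsProbabilityMeasure (haarProb ι 𝕜) :=
  ⟨Measure.haarMeasure_self (K₀ := ⊤)⟩

/-- A compact group is unimodular: a right translate of the Haar measure is a left invariant
probability measure, hence equal to it. -/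
instance instIsMulRightInvariantHaarProb : (haarProb ι 𝕜).IsMulRightInvariant := by
  refine ⟨fun g => ?_⟩
  have hp : IsProbabilityMeasure (Measure.map (· * g) (haarProb ι 𝕜)) :=
    Measure.isProbabilityMeasure_map (measurable_mul_const g).aemeasurable
  have h := Measure.isMulInvariant_eq_smul_of_compactSpace
    (Measure.map (· * g) (haarProb ι 𝕜)) (haarProb ι 𝕜)
  have h1 := congrArg (fun μ => μ Set.univ) h
  simp only [measure_univ, Measure.smul_apply] at h1
  rw [ENNReal.smul_def, smul_eq_mul, mul_one] at h1
  rw [h, ENNReal.coe_eq_one.mp h1.symm, one_smul]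

instance instSecondCountableUnitaryGroup : SecondCountableTopology (Matrix.unitaryGroup ι 𝕜) := by
  have : SecondCountableTopology (Matrix ι ι 𝕜) :=
    inferInstanceAs (SecondCountableTopology (ι → ι → 𝕜))
  exact TopologicalSpace.Subtype.secondCountableTopology _

theorem integrable_haarProb {f : Matrix.unitaryGroup ι 𝕜 → ℂ} (hf : Continuous f) :
    Integrable f (haarProb ι 𝕜) :=
  hf.integrable_of_hasCompactSupport (HasCompactSupport.of_compactSpace f)

end Haar

section Moments

variable {n : ℕ}

/-- Mixed moments vanish: flipping the sign of a Majorana operator that lies in exactly one of the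
two sets negates them. -/
theorem integral_omegaCoeff_mul_of_ne {T T' S S' : Finset (Fin (2 * n))} (h : T ≠ T' ∨ S ≠ S') :
    ∫ Q, omegaCoeff Q T S * omegaCoeff Q T' S' ∂(haarProb (Fin (2 * n)) ℝ) = 0 := by
  have aux : ∀ {V V' : Finset (Fin (2 * n))}, V ≠ V' → ∃ a, (if a ∈ V then (-1 : ℂ) else 1) *
      (if a ∈ V' then -1 else 1) = -1 := by
    intro V V' hV
    obtain ⟨a, ha⟩ : ∃ a, ¬ (a ∈ V ↔ a ∈ V') := by
      by_contra hc; push Not at hc; exact hV (Finset.ext hc)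
    refine ⟨a, ?_⟩
    by_cases h1 : a ∈ V <;> by_cases h2 : a ∈ V' <;> simp_all
  rcases h with h | h
  · obtain ⟨a, ha⟩ := aux h
    refine integral_eq_zero_of_mul_left_eq_neg (g := signFlip a) fun Q => ?_
    rw [omegaCoeff_signFlip_mul, omegaCoeff_signFlip_mul, mul_mul_mul_comm, ha, neg_one_mul]
  · obtain ⟨a, ha⟩ := aux h
    refine integral_eq_zero_of_mul_right_eq_neg (g := signFlip a) fun Q => ?_
    rw [omegaCoeff_mul_signFlip, omegaCoeff_mul_signFlip, mul_mul_mul_comm, ha, neg_one_mul]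

theorem integral_omegaCoeff_sq (T S : Finset (Fin (2 * n))) :
    ∫ Q, omegaCoeff Q T S * omegaCoeff Q T S ∂(haarProb (Fin (2 * n)) ℝ) =
      if T.card = S.card then ((2 * n).choose S.card : ℂ)⁻¹ else 0 := by
  split_ifs with h
  · -- all the averages with `|T| = |S|` agree, and they add up to one
    have hconst : ∀ V : Finset (Fin (2 * n)), V.card = S.card →
        ∫ Q, omegaCoeff Q V S * omegaCoeff Q V S ∂(haarProb (Fin (2 * n)) ℝ) =
        ∫ Q, omegaCoeff Q T S * omegaCoeff Q T S ∂(haarProb (Fin (2 * n)) ℝ) := by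
      intro V hV
      obtain ⟨σ, hσ⟩ := exists_perm_map_eq (hV.trans h.symm)
      rw [← integral_mul_left_eq_self (fun Q => omegaCoeff Q T S * omegaCoeff Q T S)
        (permOrthogonal σ)]
      refine integral_congr_ae (Filter.Eventually.of_forall fun Q => ?_)
      simp only [← hσ, omegaCoeff_permOrthogonal_mul_sq]
    have hsum : ∑ V, ∫ Q, omegaCoeff Q V S * omegaCoeff Q V S ∂(haarProb (Fin (2 * n)) ℝ) = 1 := by
      rw [← integral_finsetSum]
      · simp [sum_omegaCoeff_sq]
      · intro V _
        exact integrable_haarProb ((continuous_omegaCoeff V S).mul (continuous_omegaCoeff V S))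
    rw [← Finset.sum_subset (Finset.subset_univ (Finset.powersetCard S.card Finset.univ))] at hsum
    · rw [Finset.sum_congr rfl fun V hV => hconst V (Finset.mem_powersetCard.mp hV).2,
        Finset.sum_const, Finset.card_powersetCard, Finset.card_univ, Fintype.card_fin,
        nsmul_eq_mul] at hsum
      exact eq_inv_of_mul_eq_one_right hsum
    · intro V _ hV
      have : V.card ≠ S.card := by simpa using hV
      simp [omegaCoeff_eq_zero _ this]
  · simp [omegaCoeff_eq_zero _ h]

/-- The second moments of `ω(Q)`. These are the orthogonality relations for the representations of
`O(2n)` on the spans of the `γ[S]` with `|S| = k`, including their pairwise inequivalence. -/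
theorem integral_omegaCoeff_mul (T S T' S' : Finset (Fin (2 * n))) :
    ∫ Q, omegaCoeff Q T S * omegaCoeff Q T' S' ∂(haarProb (Fin (2 * n)) ℝ) =
      if T = T' ∧ S = S' ∧ T.card = S.card then ((2 * n).choose S.card : ℂ)⁻¹ else 0 := by
  by_cases h1 : T = T'
  · by_cases h2 : S = S'
    · subst h1 h2; simp [integral_omegaCoeff_sq]
    · rw [integral_omegaCoeff_mul_of_ne (Or.inr h2), if_neg (by tauto)]
  · rw [integral_omegaCoeff_mul_of_ne (Or.inl h1), if_neg (by tauto)]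

end Moments

/-! ### Exponential decay -/

section Decay

variable {n : ℕ}

/-- The twirl: the Haar average of a bilinear form along the diagonal action of `O(2n)`. -/
theorem integral_bilin_omega (G : Op n →ₗ[ℂ] Op n →ₗ[ℂ] ℂ) (A B : Op n) :
    ∫ Q, G (omega Q A) (omega Q B) ∂(haarProb (Fin (2 * n)) ℝ) =
      ∑ S, ((2 * n).choose S.card : ℂ)⁻¹ * (coeff S A * coeff S B) *
        ∑ T ∈ Finset.powersetCard S.card Finset.univ, G (majoranaProd T) (majoranaProd T) := by
  have hexp : ∀ (Q : Matrix.orthogonalGroup (Fin (2 * n)) ℝ) (C : Op n),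
      omega Q C = ∑ S, ∑ T, (coeff S C * omegaCoeff Q T S) • majoranaProd T := by
    intro Q C
    conv_lhs => rw [← sum_coeff_smul C]
    simp only [map_sum, map_smul, omega_majoranaProd, Finset.smul_sum, smul_smul]
  have hint : ∀ T S T' S' : Finset (Fin (2 * n)), Integrable
      (fun Q => omegaCoeff Q T S * omegaCoeff Q T' S') (haarProb (Fin (2 * n)) ℝ) :=
    fun T S T' S' =>
      integrable_haarProb ((continuous_omegaCoeff T S).mul (continuous_omegaCoeff T' S'))
  have h1 : ∀ Q : Matrix.orthogonalGroup (Fin (2 * n)) ℝ, G (omega Q A) (omega Q B) =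
      ∑ S, ∑ T, ∑ S', ∑ T', (coeff S A * coeff S' B * G (majoranaProd T) (majoranaProd T')) *
        (omegaCoeff Q T S * omegaCoeff Q T' S') := by
    intro Q
    rw [hexp Q A]
    simp only [map_sum, map_smul, LinearMap.sum_apply, LinearMap.smul_apply, smul_eq_mul]
    refine Finset.sum_congr rfl fun S _ => Finset.sum_congr rfl fun T _ => ?_
    rw [hexp Q B]
    simp only [map_sum, map_smul, smul_eq_mul, Finset.mul_sum]
    exact Finset.sum_congr rfl fun S' _ => Finset.sum_congr rfl fun T' _ => by ring
  simp only [h1]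
  rw [integral_finsetSum _ fun S _ => integrable_finsetSum _ fun T _ =>
    integrable_finsetSum _ fun S' _ => integrable_finsetSum _ fun T' _ => (hint _ _ _ _).const_mul _]
  refine Finset.sum_congr rfl fun S _ => ?_
  rw [integral_finsetSum _ fun T _ =>
    integrable_finsetSum _ fun S' _ => integrable_finsetSum _ fun T' _ => (hint _ _ _ _).const_mul _,
    Finset.mul_sum, ← Finset.sum_subset (Finset.subset_univ (Finset.powersetCard S.card _))]
  · refine Finset.sum_congr rfl fun T hT => ?_
    have hTS : T.card = S.card := (Finset.mem_powersetCard.mp hT).2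
    rw [integral_finsetSum _ fun S' _ => integrable_finsetSum _ fun T' _ =>
      (hint _ _ _ _).const_mul _, Finset.sum_eq_single S]
    · rw [integral_finsetSum _ fun T' _ => (hint _ _ _ _).const_mul _, Finset.sum_eq_single T]
      · rw [integral_const_mul, integral_omegaCoeff_mul, if_pos ⟨rfl, rfl, hTS⟩]
        ring
      · intro T' _ hne
        rw [integral_const_mul, integral_omegaCoeff_mul, if_neg (fun h => hne h.1.symm), mul_zero]
      · simp
    · intro S' _ hne
      rw [integral_finsetSum _ fun T' _ => (hint _ _ _ _).const_mul _]
      refine Finset.sum_eq_zero fun T' _ => ?_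
      rw [integral_const_mul, integral_omegaCoeff_mul, if_neg (fun h => hne h.2.1.symm), mul_zero]
    · simp
  · intro T _ hT
    have hTS : T.card ≠ S.card := by simpa using hT
    refine integral_eq_zero_of_ae (Filter.Eventually.of_forall fun Q => ?_)
    simp [omegaCoeff_eq_zero Q hTS]

/-- The noisy circuit `Λ ω(Q_m) ⋯ Λ ω(Q_1)` applied to an operator. -/
noncomputable def noisyCircuit (Λ : SuperOp n) {m : ℕ}
    (Q : Fin m → Matrix.orthogonalGroup (Fin (2 * n)) ℝ) (B : Op n) : Op n :=
  ((List.ofFn fun i => (Λ ∘ₗ omega (Q i) : Module.End ℂ (Op n))).reverse.prod) B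

theorem noisyCircuit_succ (Λ : SuperOp n) {m : ℕ}
    (Q : Fin (m + 1) → Matrix.orthogonalGroup (Fin (2 * n)) ℝ) (B : Op n) :
    noisyCircuit Λ Q B = noisyCircuit Λ (fun i => Q i.succ) (Λ (omega (Q 0) B)) := by
  simp [noisyCircuit, List.ofFn_succ]

theorem reverse_prod_ofFn_succ {G : Type*} [Monoid G] {m : ℕ} (Q : Fin (m + 1) → G) :
    (List.ofFn Q).reverse.prod = (List.ofFn fun i => Q i.succ).reverse.prod * Q 0 := by
  simp [List.ofFn_succ]

theorem continuous_omega_comp {X : Type*} [TopologicalSpace X]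
    {q : X → Matrix.orthogonalGroup (Fin (2 * n)) ℝ} {B : X → Op n} (hq : Continuous q)
    (hB : Continuous B) : Continuous fun x => omega (q x) (B x) := by
  have h : ∀ x, omega (q x) (B x) = ∑ S, coeff S (B x) • omega (q x) (majoranaProd S) := by
    intro x
    conv_lhs => rw [← sum_coeff_smul (B x)]
    simp only [map_sum, map_smul]
  simp only [h]
  refine continuous_finsetSum _ fun S _ => ?_
  exact ((continuous_linearFunctional (coeff S)).comp hB).smul ((continuous_omega _).comp hq)

theorem continuous_noisyCircuit_comp (Λ : SuperOp n) {X : Type*} [TopologicalSpace X] {m : ℕ}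
    {Q : X → Fin m → Matrix.orthogonalGroup (Fin (2 * n)) ℝ} {B : X → Op n} (hQ : Continuous Q)
    (hB : Continuous B) : Continuous fun x => noisyCircuit Λ (Q x) (B x) := by
  induction m generalizing B with
  | zero => simpa [noisyCircuit] using hB
  | succ m ih =>
    simp only [noisyCircuit_succ]
    refine ih (continuous_pi fun i => (continuous_apply i.succ).comp hQ) ?_
    exact (continuous_superOp Λ).comp
      (continuous_omega_comp ((continuous_apply 0).comp hQ) hB)

theorem continuous_reverse_prod_ofFn {G : Type*} [Monoid G] [TopologicalSpace G] [ContinuousMul G]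
    (m : ℕ) : Continuous fun Q : Fin m → G => (List.ofFn Q).reverse.prod := by
  induction m with
  | zero => simpa using continuous_const
  | succ m ih =>
    simp only [reverse_prod_ofFn_succ]
    exact (ih.comp (continuous_pi fun i => continuous_apply i.succ)).mul (continuous_apply 0)

theorem continuous_bilin_comp (G : Op n →ₗ[ℂ] Op n →ₗ[ℂ] ℂ) {X : Type*} [TopologicalSpace X]
    {A B : X → Op n} (hA : Continuous A) (hB : Continuous B) :
    Continuous fun x => G (A x) (B x) := by
  have h : ∀ x, G (A x) (B x) = ∑ S, coeff S (A x) * G (majoranaProd S) (B x) := by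
    intro x
    conv_lhs => rw [← sum_coeff_smul (A x)]
    simp
  simp only [h]
  exact continuous_finsetSum _ fun S _ => ((continuous_linearFunctional (coeff S)).comp hA).mul
    ((continuous_linearFunctional _).comp hB)

/-- Fubini for the first of `m + 1` independent Haar distributed gates. -/
theorem integral_pi_succ {ι : Type*} [Fintype ι] [DecidableEq ι] {m : ℕ}
    {F : (Fin (m + 1) → Matrix.orthogonalGroup ι ℝ) → ℂ} (hF : Continuous F) :
    ∫ Q, F Q ∂(Measure.pi fun _ => haarProb ι ℝ) =
      ∫ q, ∫ Q : Fin m → Matrix.orthogonalGroup ι ℝ, F (Fin.cons q Q)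
        ∂(Measure.pi fun _ => haarProb ι ℝ) ∂(haarProb ι ℝ) := by
  have hmp := (measurePreserving_piFinSuccAbove
    (fun _ : Fin (m + 1) => haarProb ι ℝ) 0).symm
  have hcons : ∀ p : Matrix.orthogonalGroup ι ℝ × (Fin m → Matrix.orthogonalGroup ι ℝ),
      (MeasurableEquiv.piFinSuccAbove (fun _ : Fin (m + 1) => Matrix.orthogonalGroup ι ℝ) 0).symm p =
        Fin.cons p.1 p.2 := fun p => by
    simp [MeasurableEquiv.piFinSuccAbove_symm_apply, Fin.insertNthEquiv]
  rw [← hmp.integral_comp']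
  simp only [hcons]
  rw [integral_prod]
  · have hc : Continuous fun p : Matrix.orthogonalGroup ι ℝ × (Fin m → Matrix.orthogonalGroup ι ℝ) =>
        F (Fin.cons p.1 p.2) := by
      refine hF.comp (continuous_pi fun i => ?_)
      refine Fin.cases ?_ (fun i => ?_) i
      · exact continuous_fst
      · exact (continuous_apply i).comp continuous_snd
    exact hc.integrable_of_hasCompactSupport (HasCompactSupport.of_compactSpace _)

/-- The average of a bilinear form `G` evaluated at the ideal and the noisy output of a random
circuit of length `m`. -/
noncomputable def circuitAverage (Λ : SuperOp n) (m : ℕ) (G : Op n →ₗ[ℂ] Op n →ₗ[ℂ] ℂ)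
    (A B : Op n) : ℂ :=
  ∫ Q : Fin m → Matrix.orthogonalGroup (Fin (2 * n)) ℝ,
    G (omega (List.ofFn Q).reverse.prod A) (noisyCircuit Λ Q B)
    ∂(Measure.pi fun _ => haarProb (Fin (2 * n)) ℝ)

theorem circuitAverage_zero (Λ : SuperOp n) (G : Op n →ₗ[ℂ] Op n →ₗ[ℂ] ℂ) (A B : Op n) :
    circuitAverage Λ 0 G A B = G A B := by
  simp [circuitAverage, noisyCircuit, omega_one]

theorem circuitAverage_succ (Λ : SuperOp n) (m : ℕ) (G : Op n →ₗ[ℂ] Op n →ₗ[ℂ] ℂ) (A B : Op n) :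
    circuitAverage Λ (m + 1) G A B =
      ∫ q, circuitAverage Λ m G (omega q A) (Λ (omega q B)) ∂(haarProb (Fin (2 * n)) ℝ) := by
  rw [circuitAverage, integral_pi_succ]
  · simp only [circuitAverage, reverse_prod_ofFn_succ, noisyCircuit_succ, omega_mul, Fin.cons_succ,
      Fin.cons_zero]
  · exact continuous_bilin_comp G
      (continuous_omega_comp (continuous_reverse_prod_ofFn _) continuous_const)
      (continuous_noisyCircuit_comp Λ continuous_id continuous_const)

theorem majoranaFidelity_eq (Λ : SuperOp n) (k : ℕ) :
    majoranaFidelity Λ k = ((2 * n).choose k : ℂ)⁻¹ *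
      ∑ S ∈ Finset.powersetCard k Finset.univ, coeff S (Λ (majoranaProd S)) := by
  rw [majoranaFidelity, trace_majoranaProj_comp, div_eq_inv_mul]

/-- Each gate after the first contributes one factor `λ_k` to the component of degree `k`. -/
theorem circuitAverage_eq (Λ : SuperOp n) (m : ℕ) (G : Op n →ₗ[ℂ] Op n →ₗ[ℂ] ℂ) (A B : Op n) :
    circuitAverage Λ (m + 1) G A B =
      ∑ S, ((2 * n).choose S.card : ℂ)⁻¹ * (coeff S A * coeff S B) *
        (majoranaFidelity Λ S.card ^ m *
          ∑ T ∈ Finset.powersetCard S.card Finset.univ,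
            G (majoranaProd T) (Λ (majoranaProd T))) := by
  induction m generalizing A B with
  | zero =>
    rw [circuitAverage_succ]
    simp only [circuitAverage_zero]
    have := integral_bilin_omega (G.compl₂ Λ) A B
    simpa [LinearMap.compl₂_apply] using this
  | succ m ih =>
    rw [circuitAverage_succ]
    simp only [ih]
    set κ : ℕ → ℂ := fun k => majoranaFidelity Λ k ^ m *
      ∑ T ∈ Finset.powersetCard k Finset.univ,
        G (majoranaProd T) (Λ (majoranaProd T)) with hκ
    let G' : Op n →ₗ[ℂ] Op n →ₗ[ℂ] ℂ := ∑ S, (((2 * n).choose S.card : ℂ)⁻¹ * κ S.card) •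
      (LinearMap.mul ℂ ℂ).compl₁₂ (coeff S) (coeff S ∘ₗ Λ)
    have hG' : ∀ C D : Op n, G' C D = ∑ S, ((2 * n).choose S.card : ℂ)⁻¹ *
        (coeff S C * coeff S (Λ D)) * κ S.card := by
      intro C D
      simp only [G', LinearMap.sum_apply, LinearMap.smul_apply, LinearMap.compl₁₂_apply,
        LinearMap.mul_apply', LinearMap.comp_apply, smul_eq_mul]
      exact Finset.sum_congr rfl fun S _ => by ring
    have h := integral_bilin_omega G' A B
    simp only [hG'] at h
    refine h.trans (Finset.sum_congr rfl fun S _ => ?_)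
    congr 1
    have h2 : ∀ T ∈ Finset.powersetCard S.card (Finset.univ : Finset (Fin (2 * n))),
        ∑ S', ((2 * n).choose S'.card : ℂ)⁻¹ *
          (coeff S' (majoranaProd T) * coeff S' (Λ (majoranaProd T))) * κ S'.card =
        ((2 * n).choose S.card : ℂ)⁻¹ * coeff T (Λ (majoranaProd T)) * κ S.card := by
      intro T hT
      rw [Finset.sum_eq_single T, coeff_majoranaProd, if_pos rfl, one_mul,
        (Finset.mem_powersetCard.mp hT).2]
      · intro V _ hV; rw [coeff_majoranaProd, if_neg hV]; simp
      · simp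
    rw [Finset.sum_congr rfl h2, ← Finset.sum_mul, ← Finset.mul_sum, ← majoranaFidelity_eq, hκ,
      pow_succ']
    ring

/-- Exact exponential decay, for an arbitrary superoperator `Λ`. -/
theorem decayData_eq (Λ : SuperOp n) {Φ : Matrix.orthogonalGroup (Fin (2 * n)) ℝ → SuperOp n}
    (hΦ : ∀ Q, Φ Q = Λ ∘ₗ omega Q) (ρ₀ ρ' : Op n) {E E' : Bits n → Op n}
    (hE : ∀ x, (E x)ᴴ = E x) (hE' : ∀ x, (E' x)ᴴ = E' x) (k : ℕ) (N : ℝ) (m : ℕ) :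
    decayData k N ρ₀ E Φ ρ' E' (m + 1) =
      amplitude k N ρ₀ E Λ ρ' E' * majoranaFidelity Λ k ^ m := by
  obtain rfl : Φ = fun Q => Λ ∘ₗ omega Q := funext hΦ
  let tr : Op n →ₗ[ℂ] Op n →ₗ[ℂ] ℂ :=
    (LinearMap.mul ℂ (Op n)).compr₂ (Matrix.traceLinearMap (Bits n) ℂ ℂ)
  let G : Op n →ₗ[ℂ] Op n →ₗ[ℂ] ℂ := ∑ x, (N : ℂ)⁻¹ •
    (LinearMap.mul ℂ ℂ).compl₁₂ (tr (E x) ∘ₗ majoranaProj n k) (tr (E' x))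
  have hG : ∀ A B, G A B = ∑ x, (N : ℂ)⁻¹ * (E x * majoranaProj n k A).trace *
      (E' x * B).trace := by
    intro A B
    simp [G, tr, LinearMap.sum_apply, mul_assoc]
  have h1 : decayData k N ρ₀ E (fun Q => Λ ∘ₗ omega Q) ρ' E' (m + 1) =
      circuitAverage Λ (m + 1) G ρ₀ ρ' := by
    simp only [circuitAverage, hG]
    rfl
  have h2 : ∀ S : Finset (Fin (2 * n)), ∑ T ∈ Finset.powersetCard S.card Finset.univ,
      G (majoranaProd T) (Λ (majoranaProd T)) = if S.card = k then
        ∑ T ∈ Finset.powersetCard k Finset.univ, ∑ x, (N : ℂ)⁻¹ *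
          (E x * majoranaProd T).trace * (E' x * Λ (majoranaProd T)).trace else 0 := by
    intro S
    split_ifs with h
    · subst h
      refine Finset.sum_congr rfl fun T hT => ?_
      rw [hG, majoranaProj_majoranaProd, if_pos (Finset.mem_powersetCard.mp hT).2]
    · refine Finset.sum_eq_zero fun T hT => ?_
      rw [hG, majoranaProj_majoranaProd, if_neg (by rw [(Finset.mem_powersetCard.mp hT).2]; exact h)]
      simp
  rw [h1, circuitAverage_eq]
  simp only [h2, mul_ite, mul_zero]
  rw [← Finset.sum_filter]
  have h3 : Finset.univ.filter (fun S : Finset (Fin (2 * n)) => S.card = k) =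
      Finset.powersetCard k Finset.univ := by
    ext S; simp
  rw [h3]
  have h4 : ∀ S ∈ Finset.powersetCard k (Finset.univ : Finset (Fin (2 * n))),
      ((2 * n).choose S.card : ℂ)⁻¹ * (coeff S ρ₀ * coeff S ρ') *
        (majoranaFidelity Λ S.card ^ m * ∑ T ∈ Finset.powersetCard k Finset.univ,
          ∑ x, (N : ℂ)⁻¹ * (E x * majoranaProd T).trace * (E' x * Λ (majoranaProd T)).trace) =
      (coeff S ρ₀ * coeff S ρ') * (((2 * n).choose k : ℂ)⁻¹ *
        (majoranaFidelity Λ k ^ m * ∑ T ∈ Finset.powersetCard k Finset.univ,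
          ∑ x, (N : ℂ)⁻¹ * (E x * majoranaProd T).trace *
            (E' x * Λ (majoranaProd T)).trace)) := by
    intro S hS
    rw [(Finset.mem_powersetCard.mp hS).2]; ring
  rw [Finset.sum_congr rfl h4, ← Finset.sum_mul, Finset.sum_comm (t := Finset.univ), amplitude]
  simp only [hE, hE', coeff_apply]
  have h5 : ∀ S : Finset (Fin (2 * n)), (((2 : ℂ) ^ n)⁻¹ * ((majoranaProd S)ᴴ * ρ₀).trace *
      (((2 : ℂ) ^ n)⁻¹ * ((majoranaProd S)ᴴ * ρ').trace)) = (((2 : ℂ) ^ n)⁻¹ * ((2 : ℂ) ^ n)⁻¹) *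
        (((majoranaProd S)ᴴ * ρ₀).trace * ((majoranaProd S)ᴴ * ρ').trace) := fun S => by ring
  have h6 : ∀ x, ∑ T ∈ Finset.powersetCard k Finset.univ, (N : ℂ)⁻¹ *
      (E x * majoranaProd T).trace * (E' x * Λ (majoranaProd T)).trace = (N : ℂ)⁻¹ *
      ∑ T ∈ Finset.powersetCard k Finset.univ,
        (E x * majoranaProd T).trace * (E' x * Λ (majoranaProd T)).trace := by
    intro x; rw [Finset.mul_sum]; exact Finset.sum_congr rfl fun T _ => by ring
  simp only [h5, h6, ← Finset.mul_sum, ← Finset.sum_mul]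
  ring

end Decay

/-! ### The Majorana fidelities of a channel -/

section Fidelity

variable {n : ℕ} {Λ : SuperOp n}

theorem IsChannel.map_posSemidef (hΛ : IsChannel Λ) {A : Op n} (hA : A.PosSemidef) :
    (Λ A).PosSemidef := by
  have h := (hΛ.1 1 _ (hA.submatrix (Prod.fst : Bits n × Fin 1 → Bits n))).submatrix
    (fun x : Bits n => (x, (0 : Fin 1)))
  exact h

/-- A channel preserves hermiticity, since every operator is a combination of positive
semidefinite ones (polarization). -/
theorem IsChannel.map_conjTranspose (hΛ : IsChannel Λ) (A : Op n) : Λ Aᴴ = (Λ A)ᴴ := by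
  let B : ℂ → Op n := fun c => (1 + c • A)ᴴ * (1 + c • A)
  have hB : ∀ c, (Λ (B c))ᴴ = Λ (B c) := fun c =>
    (hΛ.map_posSemidef (Matrix.posSemidef_conjTranspose_mul_self _)).isHermitian
  have hexp : ∀ c : ℂ, B c = 1 + c • A + star c • Aᴴ + (star c * c) • (Aᴴ * A) := by
    intro c
    simp only [B, Matrix.conjTranspose_add, Matrix.conjTranspose_one, Matrix.conjTranspose_smul,
      add_mul, mul_add, one_mul, mul_one, smul_mul_smul_comm]
    abel
  have h1 : A = (4 : ℂ)⁻¹ • (B 1 - B (-1) - Complex.I • B Complex.I +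
      Complex.I • B (-Complex.I)) := by
    simp only [hexp, star_neg, star_one, Complex.star_def, Complex.conj_I]
    match_scalars <;> (try ring_nf) <;> (simp <;> norm_num)
  have h2 : Aᴴ = (4 : ℂ)⁻¹ • (B 1 - B (-1) + Complex.I • B Complex.I -
      Complex.I • B (-Complex.I)) := by
    simp only [hexp, star_neg, star_one, Complex.star_def, Complex.conj_I]
    match_scalars <;> (try ring_nf) <;> (simp <;> norm_num)
  rw [h2]
  conv_rhs => rw [h1]
  simp only [map_smul, map_add, map_sub, Matrix.conjTranspose_smul, Matrix.conjTranspose_add,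
    Matrix.conjTranspose_sub, hB, Complex.star_def, Complex.conj_I, neg_smul]
  rw [show (starRingEnd ℂ) (4 : ℂ)⁻¹ = (4 : ℂ)⁻¹ by rw [map_inv₀, map_ofNat]]
  congr 1
  abel

theorem IsChannel.star_coeff (hΛ : IsChannel Λ) (S : Finset (Fin (2 * n))) :
    star (coeff S (Λ (majoranaProd S))) = coeff S (Λ (majoranaProd S)) := by
  rw [coeff_apply, star_mul', ← Matrix.trace_conjTranspose, Matrix.conjTranspose_mul,
    Matrix.conjTranspose_conjTranspose, ← hΛ.map_conjTranspose, Matrix.trace_mul_comm]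
  simp only [majoranaProd_conjTranspose, map_smul, Matrix.smul_mul, Matrix.mul_smul]
  simp

theorem IsChannel.majoranaFidelity_im (hΛ : IsChannel Λ) (k : ℕ) :
    (majoranaFidelity Λ k).im = 0 := by
  rw [← Complex.conj_eq_iff_im, majoranaFidelity_eq, map_mul, map_sum]
  congr 1
  · simp
  · exact Finset.sum_congr rfl fun S _ => hΛ.star_coeff S

theorem sum_choose_mul_majoranaFidelity (Λ : SuperOp n) :
    ∑ k ∈ Finset.range (2 * n + 1), ((2 * n).choose k : ℂ) * majoranaFidelity Λ k =
      LinearMap.trace ℂ (Op n) Λ := by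
  have h := Finset.sum_powerset (Finset.univ : Finset (Fin (2 * n)))
    (fun S => coeff S (Λ (majoranaProd S)))
  rw [Finset.powerset_univ, Finset.card_univ, Fintype.card_fin] at h
  rw [trace_superOp, h]
  refine Finset.sum_congr rfl fun k hk => ?_
  have hk' : ((2 * n).choose k : ℂ) ≠ 0 :=
    Nat.cast_ne_zero.mpr (Nat.choose_pos (by simpa [Nat.lt_succ_iff] using hk)).ne'
  rw [majoranaFidelity_eq, mul_inv_cancel_left₀ hk']

theorem majoranaFidelity_id {k : ℕ} (hk : k ≤ 2 * n) :
    majoranaFidelity (LinearMap.id : SuperOp n) k = 1 := by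
  rw [majoranaFidelity_eq]
  simp only [LinearMap.id_apply, coeff_majoranaProd, if_true, Finset.sum_const,
    Finset.card_powersetCard, Finset.card_univ, Fintype.card_fin, nsmul_eq_mul, mul_one]
  exact inv_mul_cancel₀ (Nat.cast_ne_zero.mpr (Nat.choose_pos hk).ne')

end Fidelity

/-! ### Fourth moments of a random unit vector -/

section UnitaryMoments

variable {ι : Type*} [Fintype ι] [DecidableEq ι]

/-- Integration against the Haar measure, as a linear functional on continuous functions. -/
noncomputable def haarIntegral (ι : Type*) [Fintype ι] [DecidableEq ι] :
    C(Matrix.unitaryGroup ι ℂ, ℂ) →ₗ[ℂ] ℂ where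
  toFun f := ∫ V, f V ∂(haarProb ι ℂ)
  map_add' f g := integral_add (integrable_haarProb f.continuous) (integrable_haarProb g.continuous)
  map_smul' c _ := integral_const_mul c _

theorem haarIntegral_apply (f : C(Matrix.unitaryGroup ι ℂ, ℂ)) :
    haarIntegral ι f = ∫ V, f V ∂(haarProb ι ℂ) := rfl

/-- The coordinate `V ↦ V_{xo}` of the random unit vector `V e_o`. -/
def vectorEntry (o x : ι) : C(Matrix.unitaryGroup ι ℂ, ℂ) where
  toFun V := V.1 x o
  continuous_toFun := (continuous_apply_apply x o).comp continuous_subtype_val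

/-- The fourth moment `E[ψ_x ψ̄_y ψ_z ψ̄_w]` of the random unit vector `ψ = V e_o`. -/
noncomputable def vectorMoment (o x y z w : ι) : ℂ :=
  haarIntegral ι (vectorEntry o x * star (vectorEntry o y) * vectorEntry o z *
    star (vectorEntry o w))

theorem haarIntegral_mul_left (R : Matrix.unitaryGroup ι ℂ) {f g : C(Matrix.unitaryGroup ι ℂ, ℂ)}
    (h : ∀ V, g V = f (R * V)) : haarIntegral ι g = haarIntegral ι f := by
  simp only [haarIntegral_apply, h]
  exact integral_mul_left_eq_self f R

/-- The phase gate that multiplies the coordinate `a` by `i`. -/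
noncomputable def phaseGate (a : ι) : Matrix.unitaryGroup ι ℂ :=
  ⟨Matrix.diagonal fun x => if x = a then Complex.I else 1, by
    rw [Matrix.mem_unitaryGroup_iff, Matrix.star_eq_conjTranspose, Matrix.diagonal_conjTranspose,
      Matrix.diagonal_mul_diagonal, ← Matrix.diagonal_one]
    congr 1; funext x
    by_cases h : x = a <;> simp [h]⟩

theorem vectorEntry_phaseGate_mul (o a x : ι) (V : Matrix.unitaryGroup ι ℂ) :
    vectorEntry o x (phaseGate a * V) =
      (if x = a then Complex.I else 1) * vectorEntry o x V := by
  change (Matrix.diagonal (fun x => if x = a then Complex.I else 1) * V.1) x o = _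
  rw [Matrix.diagonal_mul]; rfl

theorem vectorMoment_phase (o a x y z w : ι) :
    ((if x = a then Complex.I else 1) * star (if y = a then Complex.I else 1) *
      (if z = a then Complex.I else 1) * star (if w = a then Complex.I else 1)) *
      vectorMoment o x y z w = vectorMoment o x y z w := by
  rw [vectorMoment, ← smul_eq_mul, ← map_smul]
  refine haarIntegral_mul_left (phaseGate a) fun V => ?_
  simp only [ContinuousMap.smul_apply, ContinuousMap.mul_apply, ContinuousMap.star_apply,
    vectorEntry_phaseGate_mul, star_mul', smul_eq_mul]
  ring

/-- By invariance under the phase gates, a moment vanishes unless every coordinate occurs equally often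
with and without conjugation. -/
theorem vectorMoment_eq_zero {o x y z w : ι} (h1 : ¬ (x = y ∧ z = w)) (h2 : ¬ (x = w ∧ z = y)) :
    vectorMoment o x y z w = 0 := by
  have key : ∀ {c m : ℂ}, c * m = m → c ≠ 1 → m = 0 := by
    intro c m h hc
    have : (c - 1) * m = 0 := by rw [sub_mul, h, one_mul, sub_self]
    exact (mul_eq_zero.mp this).resolve_left (sub_ne_zero.mpr hc)
  have hI : (Complex.I : ℂ) ≠ 1 := fun h => by simpa using congrArg Complex.re h
  have hI' : (-Complex.I : ℂ) ≠ 1 := fun h => by simpa using congrArg Complex.re h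
  have hI2 : (-1 : ℂ) ≠ 1 := by norm_num
  by_cases hxy : x = y
  · have hzw : w ≠ z := fun h => h1 ⟨hxy, h.symm⟩
    refine key (vectorMoment_phase o z x y z w) ?_
    by_cases hxz : x = z
    · simp [← hxy, hxz, hzw, hI]
    · simp [← hxy, hxz, hzw, hI]
  · by_cases hxw : x = w
    · have hzy : y ≠ z := fun h => h2 ⟨hxw, h.symm⟩
      refine key (vectorMoment_phase o z x y z w) ?_
      by_cases hxz : x = z
      · simp [← hxw, hxz, hzy, hI]
      · simp [← hxw, hxz, hzy, hI]
    · refine key (vectorMoment_phase o x x y z w) ?_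
      by_cases hxz : z = x
      · simp [hxz, Ne.symm hxy, Ne.symm hxw, hI2]
      · simp [hxz, Ne.symm hxy, Ne.symm hxw, hI]

theorem vectorMoment_swap (o x y : ι) : vectorMoment o x y y x = vectorMoment o x x y y := by
  rw [vectorMoment, vectorMoment]; congr 1; ring

theorem vectorMoment_comm (o x y : ι) : vectorMoment o x x y y = vectorMoment o y y x x := by
  rw [vectorMoment, vectorMoment]; congr 1; ring

/-- The Householder reflection along `e_x - 2 e_y`; it mixes the coordinates `x` and `y` by the
matrix with rows `(3/5, 4/5)` and `(4/5, -3/5)`. -/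
noncomputable def mixGate (x y : ι) (hxy : x ≠ y) : Matrix.unitaryGroup ι ℂ :=
  ⟨1 - (2 / 5 : ℂ) • (Matrix.single x x 1 - (2 : ℂ) • Matrix.single x y 1 -
      (2 : ℂ) • Matrix.single y x 1 + (4 : ℂ) • Matrix.single y y 1), by
    have hH : (Matrix.single x x 1 - (2 : ℂ) • Matrix.single x y 1 -
      (2 : ℂ) • Matrix.single y x 1 + (4 : ℂ) • Matrix.single y y 1 : Matrix ι ι ℂ)ᴴ =
      Matrix.single x x 1 - (2 : ℂ) • Matrix.single x y 1 -
      (2 : ℂ) • Matrix.single y x 1 + (4 : ℂ) • Matrix.single y y 1 := by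
      simp only [Matrix.conjTranspose_add, Matrix.conjTranspose_sub, Matrix.conjTranspose_smul,
        Matrix.conjTranspose_single, star_one, star_ofNat]
      abel
    have h2 : (Matrix.single x x 1 - (2 : ℂ) • Matrix.single x y 1 -
      (2 : ℂ) • Matrix.single y x 1 + (4 : ℂ) • Matrix.single y y 1 : Matrix ι ι ℂ) *
      (Matrix.single x x 1 - (2 : ℂ) • Matrix.single x y 1 -
      (2 : ℂ) • Matrix.single y x 1 + (4 : ℂ) • Matrix.single y y 1) =
      (5 : ℂ) • (Matrix.single x x 1 - (2 : ℂ) • Matrix.single x y 1 -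
      (2 : ℂ) • Matrix.single y x 1 + (4 : ℂ) • Matrix.single y y 1) := by
      simp only [add_mul, sub_mul, mul_add, mul_sub, smul_mul_smul_comm, Matrix.smul_mul,
        Matrix.mul_smul, Matrix.single_mul_single_same, Matrix.single_mul_single_of_ne _ _ _ _ hxy,
        Matrix.single_mul_single_of_ne _ _ _ _ hxy.symm, mul_one, smul_zero]
      module
    rw [Matrix.mem_unitaryGroup_iff, Matrix.star_eq_conjTranspose, Matrix.conjTranspose_sub,
      Matrix.conjTranspose_smul, hH, Matrix.conjTranspose_one, sub_mul, mul_sub, mul_sub,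
      smul_mul_smul_comm, h2]
    simp only [one_mul, mul_one]
    have : star (2 / 5 : ℂ) = 2 / 5 := by simp
    rw [this]
    module⟩

theorem vectorEntry_mixGate_mul (o : ι) {x y : ι} (hxy : x ≠ y) (V : Matrix.unitaryGroup ι ℂ) :
    vectorEntry o x (mixGate x y hxy * V) =
      (3 / 5 : ℂ) * vectorEntry o x V + (4 / 5 : ℂ) * vectorEntry o y V ∧
    vectorEntry o y (mixGate x y hxy * V) =
      (4 / 5 : ℂ) * vectorEntry o x V + (-3 / 5 : ℂ) * vectorEntry o y V := by
  have h : ∀ z, vectorEntry o z (mixGate x y hxy * V) =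
    (((1 : Matrix ι ι ℂ) - (2 / 5 : ℂ) • (Matrix.single x x 1 - (2 : ℂ) • Matrix.single x y 1 -
      (2 : ℂ) • Matrix.single y x 1 + (4 : ℂ) • Matrix.single y y 1)) * V.1 : Matrix ι ι ℂ) z o :=
    fun _ => rfl
  have h' : ∀ z, vectorEntry o z V = V.1 z o := fun _ => rfl
  rw [h, h, h', h']
  simp only [add_mul, sub_mul, Matrix.smul_mul, one_mul, Matrix.add_apply, Matrix.sub_apply,
    Matrix.smul_apply, smul_eq_mul]
  constructor
  · simp [hxy]; ring
  · simp [hxy.symm]; ring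

set_option synthInstance.maxHeartbeats 200000 in
theorem haarIntegral_mix (o : ι) {x y : ι} (hxy : x ≠ y) (p q : ℂ) (hp : star p = p)
    (hq : star q = q) :
    haarIntegral ι ((p • vectorEntry o x + q • vectorEntry o y) *
      star (p • vectorEntry o x + q • vectorEntry o y) *
      (p • vectorEntry o x + q • vectorEntry o y) *
      star (p • vectorEntry o x + q • vectorEntry o y)) =
    p ^ 4 * vectorMoment o x x x x + q ^ 4 * vectorMoment o y y y y +
      4 * p ^ 2 * q ^ 2 * vectorMoment o x x y y := by
  have hm : ∀ a b c d : ι, haarIntegral ι (vectorEntry o a * star (vectorEntry o b) *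
    vectorEntry o c * star (vectorEntry o d)) = vectorMoment o a b c d := fun _ _ _ _ => rfl
  simp only [star_add, star_smul, hp, hq, add_mul, mul_add, smul_mul_assoc, mul_smul_comm,
    map_add, map_smul, hm, smul_eq_mul]
  have z1 : ∀ a b c d : ι, ¬ (a = b ∧ c = d) → ¬ (a = d ∧ c = b) → vectorMoment o a b c d = 0 :=
    fun a b c d => vectorMoment_eq_zero
  have e1 := z1 x x x y (by tauto) (by tauto)
  have e2 := z1 x x y x (by tauto) (by tauto)
  have e3 := z1 x y x x (by tauto) (by tauto)
  have e4 := z1 y x x x (by tauto) (by tauto)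
  have e5 := z1 y y y x (by tauto) (by tauto)
  have e6 := z1 y y x y (by tauto) (by tauto)
  have e7 := z1 y x y y (by tauto) (by tauto)
  have e8 := z1 x y y y (by tauto) (by tauto)
  have e9 := z1 x y x y (by tauto) (by tauto)
  have e10 := z1 y x y x (by tauto) (by tauto)
  rw [e1, e2, e3, e4, e5, e6, e7, e8, e9, e10, vectorMoment_swap o x y, vectorMoment_swap o y x,
    vectorMoment_comm o y x]
  ring

/-- Invariance under the mixing gate gives two linear equations between `E|ψ_x|⁴`, `E|ψ_y|⁴` and
`E|ψ_x|²|ψ_y|²`. -/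
theorem vectorMoment_relations (o : ι) {x y : ι} (hxy : x ≠ y) :
    vectorMoment o x x x x = vectorMoment o y y y y ∧
      vectorMoment o x x x x = 2 * vectorMoment o x x y y := by
  have hx : vectorMoment o x x x x = (3 / 5) ^ 4 * vectorMoment o x x x x +
      (4 / 5) ^ 4 * vectorMoment o y y y y +
        4 * (3 / 5) ^ 2 * (4 / 5) ^ 2 * vectorMoment o x x y y := by
    rw [← haarIntegral_mix o hxy (3 / 5) (4 / 5) (by simp) (by simp)]
    refine (haarIntegral_mul_left (mixGate x y hxy) fun V => ?_).symm
    simp only [ContinuousMap.mul_apply, ContinuousMap.star_apply, ContinuousMap.add_apply,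
      ContinuousMap.smul_apply, smul_eq_mul, (vectorEntry_mixGate_mul o hxy V).1]
  have hy : vectorMoment o y y y y = (4 / 5) ^ 4 * vectorMoment o x x x x +
      (-3 / 5) ^ 4 * vectorMoment o y y y y +
        4 * (4 / 5) ^ 2 * (-3 / 5) ^ 2 * vectorMoment o x x y y := by
    rw [← haarIntegral_mix o hxy (4 / 5) (-3 / 5) (by simp) (by simp)]
    refine (haarIntegral_mul_left (mixGate x y hxy) fun V => ?_).symm
    simp only [ContinuousMap.mul_apply, ContinuousMap.star_apply, ContinuousMap.add_apply,
      ContinuousMap.smul_apply, smul_eq_mul, (vectorEntry_mixGate_mul o hxy V).2]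
  have h1 : vectorMoment o x x x x = vectorMoment o y y y y := by
    linear_combination (625 / 800 : ℂ) * (hx - hy)
  refine ⟨h1, ?_⟩
  rw [← h1] at hx
  linear_combination (625 / 288 : ℂ) * hx

theorem sum_vectorEntry (o : ι) :
    ∑ x, vectorEntry o x * star (vectorEntry o x) = (1 : C(Matrix.unitaryGroup ι ℂ, ℂ)) := by
  ext V
  have h := congrFun (congrFun (Matrix.mem_unitaryGroup_iff'.mp V.2) o) o
  rw [Matrix.mul_apply, Matrix.one_apply_eq] at h
  simp only [ContinuousMap.sum_apply, ContinuousMap.mul_apply, ContinuousMap.star_apply,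
    ContinuousMap.one_apply]
  rw [← h]
  exact Finset.sum_congr rfl fun x _ => mul_comm _ _

theorem sum_vectorMoment (o : ι) : ∑ x, ∑ y, vectorMoment o x x y y = 1 := by
  simp only [vectorMoment, ← map_sum, mul_assoc, ← Finset.mul_sum, sum_vectorEntry, mul_one]
  simp [haarIntegral_apply]

/-- The second moment of a Haar random pure state in dimension `d` is
`(1 + SWAP) / (d (d + 1))`. -/
theorem vectorMoment_eq (o x y z w : ι) :
    vectorMoment o x y z w =
      ((Fintype.card ι : ℂ) * (Fintype.card ι + 1))⁻¹ *
        ((if x = y ∧ z = w then 1 else 0) + (if x = w ∧ z = y then 1 else 0)) := by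
  obtain ⟨κ, hκ⟩ : ∃ κ, κ = vectorMoment o o o o o / 2 := ⟨_, rfl⟩
  have hdiag : ∀ x, vectorMoment o x x x x = 2 * κ := by
    intro x
    by_cases h : x = o
    · rw [h, hκ]; ring
    · rw [(vectorMoment_relations o h).1, hκ]; ring
  have hoff : ∀ x y, vectorMoment o x x y y = κ * (1 + if x = y then 1 else 0) := by
    intro x y
    by_cases h : x = y
    · subst h; rw [hdiag, if_pos rfl]; ring
    · have := (vectorMoment_relations o h).2
      rw [hdiag] at this
      rw [if_neg h]
      linear_combination (-1 / 2 : ℂ) * this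
  have hnorm : κ * ((Fintype.card ι : ℂ) * (Fintype.card ι + 1)) = 1 := by
    refine Eq.trans ?_ (sum_vectorMoment o)
    simp only [hoff, ← Finset.mul_sum, Finset.sum_add_distrib]
    congr 1
    simp
    ring
  rw [← eq_inv_of_mul_eq_one_left hnorm]
  by_cases h1 : x = y ∧ z = w
  · obtain ⟨rfl, rfl⟩ := h1
    rw [hoff]
    by_cases h : x = z <;> simp [h, eq_comm]
  · by_cases h2 : x = w ∧ z = y
    · obtain ⟨rfl, rfl⟩ := h2
      rw [vectorMoment_swap, hoff]
      have hne : x ≠ z := fun e => h1 ⟨e, e.symm⟩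
      simp [hne]
    · rw [vectorMoment_eq_zero h1 h2]; simp [h1, h2]

end UnitaryMoments

/-! ### The average gate fidelity -/

section AvgFidelity

variable {n : ℕ}

theorem trace_superOp_eq_sum_single (Λ : SuperOp n) :
    LinearMap.trace ℂ (Op n) Λ = ∑ x, ∑ y, Λ (Matrix.single x y 1) x y := by
  rw [LinearMap.trace_eq_matrix_trace ℂ (Matrix.stdBasis ℂ (Bits n) (Bits n)), Matrix.trace,
    Fintype.sum_prod_type]
  refine Finset.sum_congr rfl fun x _ => Finset.sum_congr rfl fun y _ => ?_
  rw [Matrix.diag_apply, LinearMap.toMatrix_apply, Matrix.stdBasis_eq_single]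
  rfl

theorem avgFidelity_eq (Λ : SuperOp n) (htr : ∀ ρ, (Λ ρ).trace = ρ.trace) :
    avgFidelity Λ = ((2 ^ n : ℂ) * (2 ^ n + 1))⁻¹ * (2 ^ n + LinearMap.trace ℂ (Op n) Λ) := by
  have hpure : ∀ V : Matrix.unitaryGroup (Bits n) ℂ, pureState V =
      ∑ x, ∑ y, (V.1 x 0 * star (V.1 y 0)) • Matrix.single x y (1 : ℂ) := by
    intro V
    ext a b
    simp [pureState, Matrix.sum_apply, Matrix.single_apply, Matrix.mul_apply, ite_and]
  have hint : ∀ V : Matrix.unitaryGroup (Bits n) ℂ, (pureState V * Λ (pureState V)).trace =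
      (∑ x, ∑ y, ∑ z, ∑ w, Λ (Matrix.single x y 1) w z •
        (vectorEntry 0 x * star (vectorEntry 0 y) * vectorEntry 0 z *
          star (vectorEntry 0 w)) : C(Matrix.unitaryGroup (Bits n) ℂ, ℂ)) V := by
    intro V
    have h1 : ∀ (x y : Bits n) (B : Op n), (Matrix.single x y 1 * B).trace = B y x := by
      intro x y B
      rw [Matrix.trace_single_mul]; simp
    conv_lhs => rw [hpure V]
    simp only [Finset.sum_mul, map_sum, map_smul, Finset.mul_sum, Matrix.trace_sum,
      Matrix.smul_mul, Matrix.mul_smul, Matrix.trace_smul, h1, ContinuousMap.sum_apply,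
      ContinuousMap.smul_apply, ContinuousMap.mul_apply, ContinuousMap.star_apply, smul_eq_mul,
      vectorEntry, ContinuousMap.coe_mk]
    refine Finset.sum_congr rfl fun x _ => Finset.sum_congr rfl fun y _ => ?_
    refine Finset.sum_congr rfl fun z _ => Finset.sum_congr rfl fun w _ => ?_
    ring
  have hcard : (Fintype.card (Bits n) : ℂ) = 2 ^ n := by simp
  have hone : ∑ x, ∑ z, Λ (Matrix.single z z 1) x x = 2 ^ n := by
    have h2 : ∑ z : Bits n, Matrix.single z z (1 : ℂ) = 1 := by
      ext a b
      simp [Matrix.sum_apply, Matrix.single_apply, Matrix.one_apply, ite_and]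
    have h3 := htr 1
    rw [← h2, map_sum, Matrix.trace] at h3
    simp only [Matrix.diag_apply, Matrix.sum_apply] at h3
    rw [h3, h2, Matrix.trace_one, hcard]
  simp only [avgFidelity, hint]
  rw [← haarIntegral_apply]
  simp only [map_sum, map_smul]
  have hm : ∀ a b c d : Bits n, haarIntegral (Bits n) (vectorEntry 0 a * star (vectorEntry 0 b) *
    vectorEntry 0 c * star (vectorEntry 0 d)) = vectorMoment 0 a b c d := fun _ _ _ _ => rfl
  simp only [hm, vectorMoment_eq, hcard, smul_eq_mul]
  have hsplit : ∀ x y z w : Bits n, Λ (Matrix.single x y 1) w z *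
      (((2 ^ n : ℂ) * (2 ^ n + 1))⁻¹ *
        ((if x = y ∧ z = w then 1 else 0) + (if x = w ∧ z = y then 1 else 0))) =
      ((2 ^ n : ℂ) * (2 ^ n + 1))⁻¹ *
        ((if x = y then if z = w then Λ (Matrix.single x y 1) w z else 0 else 0) +
         (if x = w then if z = y then Λ (Matrix.single x y 1) w z else 0 else 0)) := by
    intro x y z w
    simp only [ite_and]
    split_ifs <;> ring
  simp only [hsplit, ← Finset.mul_sum, Finset.sum_add_distrib]
  rw [trace_superOp_eq_sum_single]
  congr 2
  · rw [← hone, Finset.sum_comm]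
    simp
    exact Finset.sum_comm
  · simp

end AvgFidelity

/-! ### Counting paired subsets -/

section Counting

variable {m : ℕ} {α : Type*} [DecidableEq α] (e₀ e₁ : Fin m ↪ α)

/-- The elements of `S` that lie outside of all the pairs `{e₀ j, e₁ j}`. -/
def unpairedPart (S : Finset α) : Finset α :=
  S.filter fun a => ∀ j, a ≠ e₀ j ∧ a ≠ e₁ j

variable {e₀ e₁}

theorem eq_union_of_paired {S : Finset α} (h : ∀ j, e₀ j ∈ S ↔ e₁ j ∈ S) :
    S = (Finset.univ.filter fun j => e₀ j ∈ S).map e₀ ∪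
      (Finset.univ.filter fun j => e₀ j ∈ S).map e₁ ∪ unpairedPart e₀ e₁ S := by
  ext a
  simp only [unpairedPart, Finset.mem_union, Finset.mem_map, Finset.mem_filter, Finset.mem_univ,
    true_and]
  constructor
  · intro ha
    by_cases h0 : ∃ j, e₀ j = a
    · obtain ⟨j, rfl⟩ := h0; exact Or.inl (Or.inl ⟨j, ha, rfl⟩)
    · by_cases h1 : ∃ j, e₁ j = a
      · obtain ⟨j, rfl⟩ := h1; exact Or.inl (Or.inr ⟨j, (h j).mpr ha, rfl⟩)
      · exact Or.inr ⟨ha, fun j => ⟨fun e => h0 ⟨j, e.symm⟩, fun e => h1 ⟨j, e.symm⟩⟩⟩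
  · rintro ((⟨j, hj, rfl⟩ | ⟨j, hj, rfl⟩) | h2)
    · exact hj
    · exact (h j).mp hj
    · exact h2.1

theorem card_pair_union (hd : ∀ i j, e₀ i ≠ e₁ j) (T : Finset (Fin m)) {R : Finset α}
    (hR : ∀ a ∈ R, ∀ j, a ≠ e₀ j ∧ a ≠ e₁ j) :
    (T.map e₀ ∪ T.map e₁ ∪ R).card = 2 * T.card + R.card := by
  rw [Finset.card_union_of_disjoint, Finset.card_union_of_disjoint, Finset.card_map,
    Finset.card_map, two_mul]
  · rw [Finset.disjoint_left]
    intro a h0 h1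
    obtain ⟨i, _, rfl⟩ := Finset.mem_map.mp h0
    obtain ⟨j, _, h⟩ := Finset.mem_map.mp h1
    exact hd i j h.symm
  · rw [Finset.disjoint_left]
    intro a h0 h1
    rcases Finset.mem_union.mp h0 with h | h
    · obtain ⟨i, _, rfl⟩ := Finset.mem_map.mp h; exact (hR _ h1 i).1 rfl
    · obtain ⟨i, _, rfl⟩ := Finset.mem_map.mp h; exact (hR _ h1 i).2 rfl

theorem card_of_paired (hd : ∀ i j, e₀ i ≠ e₁ j) {S : Finset α}
    (h : ∀ j, e₀ j ∈ S ↔ e₁ j ∈ S) :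
    S.card = 2 * (Finset.univ.filter fun j => e₀ j ∈ S).card + (unpairedPart e₀ e₁ S).card := by
  conv_lhs => rw [eq_union_of_paired h]
  exact card_pair_union hd _ fun a ha => (Finset.mem_filter.mp ha).2

/-- The unions of `l` pairs with a fixed set `R` of unpaired elements are counted by the subsets of
size `l` of the set of all pairs. -/
theorem card_filter_paired [Fintype α] (hd : ∀ i j, e₀ i ≠ e₁ j) {R : Finset α}
    (hR : ∀ a ∈ R, ∀ j, a ≠ e₀ j ∧ a ≠ e₁ j) (l : ℕ) :
    ((Finset.powersetCard (2 * l + R.card) (Finset.univ : Finset α)).filter fun S =>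
      (∀ j, e₀ j ∈ S ↔ e₁ j ∈ S) ∧ unpairedPart e₀ e₁ S = R).card = m.choose l := by
  have hmem₀ : ∀ (T : Finset (Fin m)) j, e₀ j ∈ T.map e₀ ∪ T.map e₁ ∪ R ↔ j ∈ T := by
    intro T j
    have h1 : e₀ j ∉ R := fun h => (hR _ h j).1 rfl
    have h2 : ∀ i, e₁ i ≠ e₀ j := fun i => (hd j i).symm
    simp [h1, h2]
  have hmem₁ : ∀ (T : Finset (Fin m)) j, e₁ j ∈ T.map e₀ ∪ T.map e₁ ∪ R ↔ j ∈ T := by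
    intro T j
    have h1 : e₁ j ∉ R := fun h => (hR _ h j).2 rfl
    simp [h1, hd]
  have hcard : (Finset.powersetCard l (Finset.univ : Finset (Fin m))).card = m.choose l := by
    simp
  rw [← hcard]
  refine Finset.card_nbij' (fun S => Finset.univ.filter fun j => e₀ j ∈ S)
    (fun T => T.map e₀ ∪ T.map e₁ ∪ R) ?_ ?_ ?_ ?_
  · intro S hS
    obtain ⟨h1, h2, h3⟩ := Finset.mem_filter.mp hS
    have h4 := card_of_paired hd h2
    rw [h3, (Finset.mem_powersetCard.mp h1).2] at h4
    have h5 : (Finset.univ.filter fun j => e₀ j ∈ S).card = l := by omega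
    exact Finset.mem_powersetCard.mpr ⟨Finset.subset_univ _, h5⟩
  · intro T hT
    have hT' := (Finset.mem_powersetCard.mp hT).2
    refine Finset.mem_filter.mpr ⟨Finset.mem_powersetCard.mpr ⟨Finset.subset_univ _, ?_⟩,
      fun j => by rw [hmem₀, hmem₁], ?_⟩
    · rw [card_pair_union hd T hR, hT']
    · ext a
      simp only [unpairedPart, Finset.mem_filter, Finset.mem_union, Finset.mem_map]
      constructor
      · rintro ⟨(⟨j, _, rfl⟩ | ⟨j, _, rfl⟩) | h, h'⟩
        · exact absurd rfl (h' j).1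
        · exact absurd rfl (h' j).2
        · exact h
      · intro h; exact ⟨Or.inr h, hR a h⟩
  · intro S hS
    obtain ⟨_, h2, h3⟩ := Finset.mem_filter.mp hS
    have := eq_union_of_paired h2
    rw [h3] at this
    exact this.symm
  · intro T _
    ext j
    simp only [Finset.mem_filter, Finset.mem_univ, true_and]
    exact hmem₀ T j

end Counting

/-! ### Diagonal entries of Majorana products -/

section Diagonal

variable {n : ℕ}

theorem tensorOp_diagonal (d : Fin n → Fin 2 → ℂ) :
    tensorOp (fun i => Matrix.diagonal (d i)) =
      Matrix.diagonal fun x : Bits n => ∏ i, d i (x i) := by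
  ext x y
  by_cases h : x = y
  · subst h; simp [tensorOp]
  · obtain ⟨i, hi⟩ := Function.ne_iff.mp h
    rw [Matrix.diagonal_apply_ne _ h]
    exact Finset.prod_eq_zero (Finset.mem_univ i) (Matrix.diagonal_apply_ne _ hi)

/-- The eigenvalue of `Z` on a computational basis state of one qubit. -/
def pauliSign (b : Fin 2) : ℂ := if b = 0 then 1 else -1

theorem pauliSign_mul_self (b : Fin 2) : pauliSign b * pauliSign b = 1 := by
  fin_cases b <;> simp [pauliSign]

theorem pauliSign_injective : Function.Injective pauliSign := by
  intro a b h
  fin_cases a <;> fin_cases b <;> simp [pauliSign] at h ⊢ <;> norm_num at h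

theorem onQubit_pauliZ (j : Fin n) :
    onQubit j pauliZ = Matrix.diagonal fun x : Bits n => pauliSign (x j) := by
  have h1 : pauliZ = Matrix.diagonal pauliSign := by
    ext a b; fin_cases a <;> fin_cases b <;> simp [pauliZ, pauliSign]
  have h2 : (fun i => if i = j then pauliZ else 1) =
      fun i => Matrix.diagonal (if i = j then pauliSign else fun _ => 1) := by
    funext i
    split_ifs
    · exact h1
    · exact Matrix.diagonal_one.symm
  rw [onQubit, h2, tensorOp_diagonal]
  congr 1; funext x
  rw [Finset.prod_eq_single j]
  · simp
  · intro i _ hi; simp [hi]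
  · simp

theorem apply_self_eq_zero_of_diagonal_conj {ι : Type*} [Fintype ι] [DecidableEq ι]
    {M : Matrix ι ι ℂ} {χ : ι → ℂ} (hχ : ∀ x, χ x * χ x = 1)
    (h : Matrix.diagonal χ * M * Matrix.diagonal χ = -M) (x : ι) : M x x = 0 := by
  have h1 := congrFun (congrFun h x) x
  rw [Matrix.mul_diagonal, Matrix.diagonal_mul, mul_right_comm, hχ, one_mul, Matrix.neg_apply] at h1
  linear_combination (1 / 2 : ℂ) * h1

/-- A unitary matrix that commutes with a set of diagonal matrices separating the basis states is
diagonal, so that its diagonal entries are unimodular. -/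
theorem apply_self_mul_star_eq_one {ι : Type*} [Fintype ι] [DecidableEq ι] {M : Matrix ι ι ℂ}
    (hM : M * Mᴴ = 1) {X : Set (ι → ℂ)} (hX : ∀ x y, (∀ χ ∈ X, χ x = χ y) → x = y)
    (hsq : ∀ χ ∈ X, ∀ x, χ x * χ x = 1)
    (h : ∀ χ ∈ X, Matrix.diagonal χ * M * Matrix.diagonal χ = M) (x : ι) :
    M x x * star (M x x) = 1 := by
  have hoff : ∀ y, y ≠ x → M x y = 0 := by
    intro y hy
    by_contra hne
    refine hy (hX y x fun χ hχ => ?_)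
    have h1 := congrFun (congrFun (h χ hχ) x) y
    rw [Matrix.mul_diagonal, Matrix.diagonal_mul] at h1
    have h2 : χ x * χ y = 1 := mul_right_cancel₀ hne (by linear_combination h1)
    linear_combination χ x * h2 - χ y * hsq χ hχ x
  have h1 := congrFun (congrFun hM x) x
  rw [Matrix.mul_apply, Matrix.one_apply_eq, Finset.sum_eq_single x] at h1
  · exact h1
  · intro y _ hy; rw [hoff y hy, zero_mul]
  · simp

/-- Conjugation by the hermitian Pauli operator `K = -i γ_a γ_b`. -/
theorem pauli_pair_conj {a b : Fin (2 * n)} {K : Op n} (hK : Kᴴ = K)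
    (h : (majorana a : Op n) * majorana b = Complex.I • K) (S : Finset (Fin (2 * n))) :
    K * majoranaProd S * K = (if a ∈ S ↔ b ∈ S then (1 : ℂ) else -1) • majoranaProd S := by
  have h2 : (majorana b : Op n) * majorana a = -(Complex.I • K) := by
    have := congrArg Matrix.conjTranspose h
    simpa [Matrix.conjTranspose_mul, majorana_conjTranspose, Matrix.conjTranspose_smul, hK]
      using this
  have h3 : majorana a * majorana b * majoranaProd S * (majorana b * majorana a) =
      (conjSign S b * conjSign S a) • (majoranaProd S : Op n) := by
    have : majorana a * majorana b * majoranaProd S * (majorana b * majorana a) =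
        majorana a * (majorana b * majoranaProd S * majorana b) * (majorana a : Op n) := by
      simp only [mul_assoc]
    rw [this, majorana_conj_majoranaProd, mul_smul_comm, smul_mul_assoc,
      majorana_conj_majoranaProd, smul_smul]
  rw [h, h2] at h3
  have h4 : Complex.I • K * majoranaProd S * -(Complex.I • K) = K * majoranaProd S * K := by
    simp [smul_smul]
  rw [h4] at h3
  rw [h3]
  congr 1
  by_cases ha : a ∈ S <;> by_cases hb : b ∈ S <;> simp [conjSign, ha, hb, ← mul_pow]

theorem star_trace_mul_majoranaProd {A : Op n} (hA : Aᴴ = A) (S : Finset (Fin (2 * n))) :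
    star (A * majoranaProd S).trace = reversalSign S.card * (A * majoranaProd S).trace := by
  rw [← Matrix.trace_conjTranspose, Matrix.conjTranspose_mul, hA, majoranaProd_conjTranspose,
    Matrix.smul_mul, Matrix.trace_smul, smul_eq_mul, Matrix.trace_mul_comm]

/-- In the noise-free limit the amplitude only depends on the number of Majorana products of degree
`k` that have a non-zero expectation value in the states of the measurement basis. -/
theorem amplitude_id_eq {k : ℕ} (N : ℝ) {E : Bits n → Op n} (hE : ∀ x, (E x)ᴴ = E x)
    (good : Finset (Fin (2 * n)) → Prop) [DecidablePred good]
    (h : ∀ x, ∀ S : Finset (Fin (2 * n)), S.card = k →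
      (E x * majoranaProd S).trace * star (E x * majoranaProd S).trace =
        if good S then 1 else 0) :
    amplitude k N (E 0) E LinearMap.id (E 0) E =
      (N : ℂ)⁻¹ * ((((2 : ℝ) ^ n)⁻¹ *
        (((Finset.powersetCard k (Finset.univ : Finset (Fin (2 * n)))).filter good).card : ℝ) ^ 2 *
        ((2 * n).choose k : ℝ)⁻¹ : ℝ) : ℂ) := by
  have h1 : ∀ x, ∀ S : Finset (Fin (2 * n)), S.card = k →
      (E x * majoranaProd S).trace * (E x * majoranaProd S).trace =
        reversalSign k * if good S then 1 else 0 := by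
    intro x S hS
    rw [← h x S hS, star_trace_mul_majoranaProd (hE x), hS]
    linear_combination -((E x * majoranaProd S).trace * (E x * majoranaProd S).trace) *
      reversalSign_mul_self k
  have h2 : ∀ S : Finset (Fin (2 * n)), S.card = k →
      ((majoranaProd S)ᴴ * E 0).trace * ((majoranaProd S)ᴴ * E 0).trace =
        reversalSign k * if good S then 1 else 0 := by
    intro S hS
    rw [← h1 0 S hS, majoranaProd_conjTranspose, Matrix.smul_mul, Matrix.trace_smul, smul_eq_mul,
      mul_mul_mul_comm, reversalSign_mul_self, one_mul, Matrix.trace_mul_comm]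
  have h3 : ∀ x, ∑ S ∈ Finset.powersetCard k (Finset.univ : Finset (Fin (2 * n))),
      ((E x)ᴴ * majoranaProd S).trace * ((E x)ᴴ * (LinearMap.id : SuperOp n)
        (majoranaProd S)).trace = reversalSign k * ((Finset.powersetCard k
          (Finset.univ : Finset (Fin (2 * n)))).filter good).card := by
    intro x
    rw [Finset.sum_congr rfl fun S hS => by
      rw [hE, LinearMap.id_apply, h1 x S (Finset.mem_powersetCard.mp hS).2], ← Finset.mul_sum,
      Finset.sum_boole]
  have h4 : ∑ S ∈ Finset.powersetCard k (Finset.univ : Finset (Fin (2 * n))),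
      ((majoranaProd S)ᴴ * E 0).trace * ((majoranaProd S)ᴴ * E 0).trace =
        reversalSign k * ((Finset.powersetCard k
          (Finset.univ : Finset (Fin (2 * n)))).filter good).card := by
    rw [Finset.sum_congr rfl fun S hS => h2 S (Finset.mem_powersetCard.mp hS).2, ← Finset.mul_sum,
      Finset.sum_boole]
  rw [amplitude]
  simp only [h3, h4, Finset.sum_const, Finset.card_univ, nsmul_eq_mul]
  have h5 : (Fintype.card (Bits n) : ℂ) = 2 ^ n := by simp
  have h6 : (2 : ℂ) ^ n ≠ 0 := by positivity
  have h7 := reversalSign_mul_self k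
  rw [h5]
  push_cast
  have h8 := mul_inv_cancel₀ h6
  generalize (2 : ℂ) ^ n = q at h8 ⊢
  generalize (((Finset.powersetCard k
    (Finset.univ : Finset (Fin (2 * n)))).filter good).card : ℂ) = c
  linear_combination ((N : ℂ)⁻¹ * ((2 * n).choose k : ℂ)⁻¹ * q⁻¹ * c ^ 2) *
    (reversalSign k ^ 2 * h8 + h7)

end Diagonal

/-! ### The noise-free limit -/

section Normalization

variable {n : ℕ}

theorem amplitude_eq_one_iff {k : ℕ} {ν : ℝ} (hν : ν ≠ 0) {E : Bits n → Op n}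
    (h : ∀ N : ℝ, amplitude k N (E 0) E LinearMap.id (E 0) E = (N : ℂ)⁻¹ * (ν : ℂ)) (N : ℝ) :
    amplitude k N (E 0) E LinearMap.id (E 0) E = 1 ↔ N = ν := by
  rw [h N, ← Complex.ofReal_inv, ← Complex.ofReal_mul, Complex.ofReal_eq_one, inv_mul_eq_div]
  constructor
  · intro h1
    by_cases hN : N = 0
    · simp [hN] at h1
    · exact (eq_of_div_eq_one h1).symm
  · rintro rfl; exact div_self hν

theorem decayData_noiseless {k : ℕ} (hk : k ≤ 2 * n) {N : ℝ} {E : Bits n → Op n}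
    (hE : ∀ x, (E x)ᴴ = E x) (h : amplitude k N (E 0) E LinearMap.id (E 0) E = 1) {m : ℕ}
    (hm : 1 ≤ m) : decayData k N (E 0) E omega (E 0) E m = 1 := by
  obtain ⟨m, rfl⟩ := Nat.exists_eq_add_of_le' hm
  rw [decayData_eq LinearMap.id (fun Q => (LinearMap.id_comp _).symm) _ _ hE hE, h,
    majoranaFidelity_id hk, one_pow, one_mul]

/-! ### Measurement in the `Z` basis -/

/-- The indices of the Majorana operators `Z ⋯ Z X_j`. -/
def evenIndex (n : ℕ) : Fin n ↪ Fin (2 * n) :=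
  ⟨fun j => ⟨2 * j.val, by have := j.2; omega⟩, fun i j h => by
    have := congrArg Fin.val h; simp only at this; exact Fin.ext (by omega)⟩

/-- The indices of the Majorana operators `Z ⋯ Z Y_j`. -/
def oddIndex (n : ℕ) : Fin n ↪ Fin (2 * n) :=
  ⟨fun j => ⟨2 * j.val + 1, by have := j.2; omega⟩, fun i j h => by
    have := congrArg Fin.val h; simp only at this; exact Fin.ext (by omega)⟩

theorem evenIndex_val (j : Fin n) : (evenIndex n j).val = 2 * j.val := rfl

theorem oddIndex_val (j : Fin n) : (oddIndex n j).val = 2 * j.val + 1 := rfl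

theorem zEffect_conjTranspose (x : Bits n) : (zEffect x)ᴴ = zEffect x := by
  simp [zEffect, Matrix.conjTranspose_single]

theorem trace_single_self_mul (x : Bits n) (A : Op n) : (Matrix.single x x 1 * A).trace = A x x := by
  rw [Matrix.trace_single_mul]; simp

theorem onQubit_pauliZ_conj_majoranaProd (j : Fin n) (S : Finset (Fin (2 * n))) :
    onQubit j pauliZ * majoranaProd S * onQubit j pauliZ =
      (if evenIndex n j ∈ S ↔ oddIndex n j ∈ S then (1 : ℂ) else -1) • (majoranaProd S : Op n) :=
  pauli_pair_conj (by rw [onQubit_conjTranspose, pauliZ_conjTranspose])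
    (majorana_mul_majorana_eq_pauliZ j rfl rfl) S

open Classical in
/-- `γ[S]` has diagonal entries of modulus one if it is, up to a phase, a product of operators `Z_j`,
and vanishing diagonal entries otherwise. -/
theorem trace_zEffect_mul_star (x : Bits n) (S : Finset (Fin (2 * n))) :
    (zEffect x * majoranaProd S).trace * star (zEffect x * majoranaProd S).trace =
      if ∀ j, evenIndex n j ∈ S ↔ oddIndex n j ∈ S then 1 else 0 := by
  rw [zEffect, trace_single_self_mul]
  split_ifs with h
  · refine apply_self_mul_star_eq_one (majoranaProd_mul_conjTranspose S)
      (X := Set.range fun (j : Fin n) (y : Bits n) => pauliSign (y j)) ?_ ?_ ?_ x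
    · intro y z hyz
      funext j
      exact pauliSign_injective (hyz _ ⟨j, rfl⟩)
    · rintro _ ⟨j, rfl⟩ y; exact pauliSign_mul_self _
    · rintro _ ⟨j, rfl⟩
      rw [← onQubit_pauliZ, onQubit_pauliZ_conj_majoranaProd, if_pos (h j), one_smul]
  · push Not at h
    obtain ⟨j, hj⟩ := h
    have hz : (majoranaProd S : Op n) x x = 0 := by
      refine apply_self_eq_zero_of_diagonal_conj (χ := fun y => pauliSign (y j))
        (fun y => pauliSign_mul_self _) ?_ x
      rw [← onQubit_pauliZ, onQubit_pauliZ_conj_majoranaProd, if_neg (by tauto), neg_one_smul]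
    rw [hz, zero_mul]

open Classical in
theorem card_filter_evenIndex_oddIndex (l : ℕ) :
    ((Finset.powersetCard (2 * l) (Finset.univ : Finset (Fin (2 * n)))).filter fun S =>
      ∀ j, evenIndex n j ∈ S ↔ oddIndex n j ∈ S).card = n.choose l := by
  have hd : ∀ i j, evenIndex n i ≠ oddIndex n j := fun i j h => by
    have := congrArg Fin.val h; rw [evenIndex_val, oddIndex_val] at this; omega
  rw [← card_filter_paired hd (R := ∅) (by simp) l]
  congr 1
  ext S
  simp only [Finset.mem_filter, Finset.card_empty, add_zero, and_congr_right_iff]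
  intro _
  refine ⟨fun h => ⟨h, ?_⟩, fun h => h.1⟩
  refine Finset.filter_eq_empty_iff.mpr fun a _ ha => ?_
  have ha2 := a.2
  rcases Nat.mod_two_eq_zero_or_one a.val with h2 | h2
  · exact (ha ⟨a.val / 2, by omega⟩).1 (Fin.ext (by
      rw [evenIndex_val]; dsimp only; omega))
  · exact (ha ⟨a.val / 2, by omega⟩).2 (Fin.ext (by
      rw [oddIndex_val]; dsimp only; omega))

theorem normZ_ne_zero {k : ℕ} (hk : k ≤ 2 * n) : normZ n k ≠ 0 := by
  have h1 : (n.choose (k / 2) : ℝ) ≠ 0 :=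
    Nat.cast_ne_zero.mpr (Nat.choose_pos (by omega)).ne'
  have h2 : ((2 * n).choose k : ℝ) ≠ 0 := Nat.cast_ne_zero.mpr (Nat.choose_pos hk).ne'
  have h3 : (2 ^ n : ℝ) ≠ 0 := by positivity
  exact mul_ne_zero (mul_ne_zero (inv_ne_zero h3) (pow_ne_zero _ h1)) (inv_ne_zero h2)

theorem amplitude_zEffect {k : ℕ} (hk : Even k) (N : ℝ) :
    amplitude k N (zEffect (n := n) 0) zEffect LinearMap.id (zEffect 0) zEffect =
      (N : ℂ)⁻¹ * (normZ n k : ℂ) := by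
  classical
  obtain ⟨l, rfl⟩ := hk
  rw [← two_mul, amplitude_id_eq N zEffect_conjTranspose
    (fun S => ∀ j, evenIndex n j ∈ S ↔ oddIndex n j ∈ S) fun x S _ => trace_zEffect_mul_star x S,
    card_filter_evenIndex_oddIndex, normZ, Nat.mul_div_cancel_left l two_pos]

/-! ### Measurement in the `X` basis -/

/-- The Hadamard gate on every qubit. -/
noncomputable def hadamardAll (n : ℕ) : Op n := tensorOp fun _ => hadamard

theorem hadamard_mul_self : hadamard * hadamard = 1 := by
  have h : (((Real.sqrt 2 : ℝ) : ℂ)⁻¹ * ((Real.sqrt 2 : ℝ) : ℂ)⁻¹) = 1 / 2 := by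
    rw [← mul_inv, ← Complex.ofReal_mul, Real.mul_self_sqrt (by norm_num)]; norm_num
  rw [hadamard, smul_mul_smul_comm, h]
  ext i j; fin_cases i <;> fin_cases j <;> simp <;> norm_num

theorem hadamard_conjTranspose : hadamardᴴ = hadamard := by
  ext i j; fin_cases i <;> fin_cases j <;> simp [hadamard]

theorem hadamard_mul_pauliX_mul_hadamard : hadamard * pauliX * hadamard = pauliZ := by
  have h : (((Real.sqrt 2 : ℝ) : ℂ)⁻¹ * ((Real.sqrt 2 : ℝ) : ℂ)⁻¹) = 1 / 2 := by
    rw [← mul_inv, ← Complex.ofReal_mul, Real.mul_self_sqrt (by norm_num)]; norm_num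
  rw [hadamard, Matrix.smul_mul, smul_mul_smul_comm, h]
  ext i j; fin_cases i <;> fin_cases j <;> simp [pauliX, pauliZ] <;> norm_num

theorem hadamardAll_mul_self : hadamardAll n * hadamardAll n = 1 :=
  tensorOp_mul_self fun _ => hadamard_mul_self

theorem hadamardAll_conjTranspose : (hadamardAll n)ᴴ = hadamardAll n := by
  rw [hadamardAll, tensorOp_conjTranspose, hadamard_conjTranspose]

theorem hadamardAll_conj_onQubit (j : Fin n) :
    hadamardAll n * onQubit j pauliX * hadamardAll n = onQubit j pauliZ := by
  rw [hadamardAll, onQubit, tensorOp_mul, tensorOp_mul, onQubit]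
  congr 1; funext i
  split_ifs
  · exact hadamard_mul_pauliX_mul_hadamard
  · rw [mul_one, hadamard_mul_self]

theorem hadamardAll_conj_mul (A B : Op n) :
    hadamardAll n * A * hadamardAll n * (hadamardAll n * B * hadamardAll n) =
      hadamardAll n * (A * B) * hadamardAll n := by
  rw [show hadamardAll n * A * hadamardAll n * (hadamardAll n * B * hadamardAll n) =
    hadamardAll n * A * (hadamardAll n * hadamardAll n) * B * hadamardAll n by
      simp only [mul_assoc], hadamardAll_mul_self, mul_one]
  simp only [mul_assoc]

theorem xEffect_conjTranspose (x : Bits n) : (xEffect x)ᴴ = xEffect x := by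
  have h : (hadamardAll n * Matrix.single x x 1 * hadamardAll n)ᴴ =
      hadamardAll n * Matrix.single x x 1 * hadamardAll n := by
    simp [Matrix.conjTranspose_mul, hadamardAll_conjTranspose, Matrix.conjTranspose_single,
      mul_assoc]
  exact h

theorem trace_xEffect_mul (x : Bits n) (A : Op n) :
    (xEffect x * A).trace = (hadamardAll n * A * hadamardAll n) x x := by
  refine Eq.trans ?_ (trace_single_self_mul x _)
  have h : xEffect x = hadamardAll n * Matrix.single x x 1 * hadamardAll n := rfl
  rw [h, mul_assoc, mul_assoc, Matrix.trace_mul_comm]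
  simp only [mul_assoc]

/-- The indices of the Majorana operators `Z ⋯ Z Y_i` with `i` not the last qubit. -/
def innerOddIndex (n : ℕ) : Fin (n - 1) ↪ Fin (2 * n) :=
  ⟨fun j => ⟨2 * j.val + 1, by have := j.2; omega⟩, fun i j h => by
    have := congrArg Fin.val h; simp only at this; exact Fin.ext (by omega)⟩

/-- The indices of the Majorana operators `Z ⋯ Z X_i` with `i` not the first qubit. -/
def innerEvenIndex (n : ℕ) : Fin (n - 1) ↪ Fin (2 * n) :=
  ⟨fun j => ⟨2 * j.val + 2, by have := j.2; omega⟩, fun i j h => by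
    have := congrArg Fin.val h; simp only at this; exact Fin.ext (by omega)⟩

theorem innerOddIndex_val (j : Fin (n - 1)) : (innerOddIndex n j).val = 2 * j.val + 1 := rfl

theorem innerEvenIndex_val (j : Fin (n - 1)) : (innerEvenIndex n j).val = 2 * j.val + 2 := rfl

/-- The operator `X_i X_{i+1}`. -/
def neighbourX (i : Fin (n - 1)) : Op n :=
  onQubit ⟨i.val, by have := i.2; omega⟩ pauliX * onQubit ⟨i.val + 1, by have := i.2; omega⟩ pauliX

theorem neighbourX_conj_majoranaProd (i : Fin (n - 1)) (S : Finset (Fin (2 * n))) :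
    neighbourX i * majoranaProd S * neighbourX i =
      (if innerOddIndex n i ∈ S ↔ innerEvenIndex n i ∈ S then (1 : ℂ) else -1) •
        (majoranaProd S : Op n) := by
  have hK : (neighbourX i : Op n)ᴴ = neighbourX i := by
    rw [neighbourX, Matrix.conjTranspose_mul, onQubit_conjTranspose, onQubit_conjTranspose,
      pauliX_conjTranspose, onQubit, onQubit]
    refine tensorOp_comm fun l => ?_
    split_ifs <;> simp
  exact pauli_pair_conj hK (majorana_mul_majorana_eq_pauliX rfl rfl rfl) S

theorem hadamardAll_conj_neighbourX (i : Fin (n - 1)) :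
    hadamardAll n * neighbourX i * hadamardAll n = Matrix.diagonal fun x : Bits n =>
      pauliSign (x ⟨i.val, by have := i.2; omega⟩) *
        pauliSign (x ⟨i.val + 1, by have := i.2; omega⟩) := by
  rw [neighbourX, ← hadamardAll_conj_mul, hadamardAll_conj_onQubit, hadamardAll_conj_onQubit,
    onQubit_pauliZ, onQubit_pauliZ, Matrix.diagonal_mul_diagonal]

theorem onQubit_zero_conj_majoranaProd (hn : 0 < n) (S : Finset (Fin (2 * n))) :
    onQubit ⟨0, hn⟩ pauliX * majoranaProd S * onQubit ⟨0, hn⟩ pauliX =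
      conjSign S ⟨0, by omega⟩ • (majoranaProd S : Op n) := by
  have h : (onQubit ⟨0, hn⟩ pauliX : Op n) = majorana ⟨0, by omega⟩ := by
    rw [onQubit, majorana]
    congr 1; funext i
    by_cases hi : i.val = 0 <;> simp [hi, Fin.ext_iff]
  rw [h, majorana_conj_majoranaProd]

open Classical in
/-- For odd `|S|`, the operator `γ[S]` has a non-zero expectation value in the states of the `X` basis
if and only if it commutes with `X_0` and with all `X_i X_{i+1}`. -/
theorem trace_xEffect_mul_star (hn : 0 < n) (x : Bits n) {S : Finset (Fin (2 * n))}
    (hS : Odd S.card) :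
    (xEffect x * majoranaProd S).trace * star (xEffect x * majoranaProd S).trace =
      if (∀ i, innerOddIndex n i ∈ S ↔ innerEvenIndex n i ∈ S) ∧ (⟨0, by omega⟩ : Fin (2 * n)) ∈ S
        then 1 else 0 := by
  -- after conjugation by the Hadamard gates the operators `X_0` and `X_i X_{i+1}` are diagonal
  have h₀ : Matrix.diagonal (fun y : Bits n => pauliSign (y ⟨0, hn⟩)) *
      (hadamardAll n * majoranaProd S * hadamardAll n) *
      Matrix.diagonal (fun y : Bits n => pauliSign (y ⟨0, hn⟩)) =
      conjSign S ⟨0, by omega⟩ • (hadamardAll n * majoranaProd S * hadamardAll n) := by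
    rw [← onQubit_pauliZ, ← hadamardAll_conj_onQubit, hadamardAll_conj_mul, hadamardAll_conj_mul,
      onQubit_zero_conj_majoranaProd, Matrix.mul_smul, Matrix.smul_mul]
  have h₁ : ∀ i : Fin (n - 1), Matrix.diagonal (fun x : Bits n =>
      pauliSign (x ⟨i.val, by have := i.2; omega⟩) *
        pauliSign (x ⟨i.val + 1, by have := i.2; omega⟩)) *
      (hadamardAll n * majoranaProd S * hadamardAll n) * Matrix.diagonal (fun x : Bits n =>
      pauliSign (x ⟨i.val, by have := i.2; omega⟩) *
        pauliSign (x ⟨i.val + 1, by have := i.2; omega⟩)) =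
      (if innerOddIndex n i ∈ S ↔ innerEvenIndex n i ∈ S then (1 : ℂ) else -1) •
        (hadamardAll n * majoranaProd S * hadamardAll n) := by
    intro i
    rw [← hadamardAll_conj_neighbourX, hadamardAll_conj_mul, hadamardAll_conj_mul,
      neighbourX_conj_majoranaProd, Matrix.mul_smul, Matrix.smul_mul]
  have hsign : ∀ a, conjSign S a = if a ∈ S then 1 else -1 := by
    intro a
    rw [conjSign, hS.neg_one_pow]; split_ifs <;> simp
  have hsq : ∀ a b : Fin 2, pauliSign a * pauliSign b * (pauliSign a * pauliSign b) = 1 := by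
    intro a b
    rw [mul_mul_mul_comm, pauliSign_mul_self, pauliSign_mul_self, one_mul]
  rw [hsign] at h₀
  rw [trace_xEffect_mul]
  split_ifs with h
  · refine apply_self_mul_star_eq_one (X := insert (fun y : Bits n => pauliSign (y ⟨0, hn⟩))
      (Set.range fun (i : Fin (n - 1)) (x : Bits n) =>
        pauliSign (x ⟨i.val, by have := i.2; omega⟩) *
          pauliSign (x ⟨i.val + 1, by have := i.2; omega⟩))) ?_ ?_ ?_ ?_ x
    · rw [Matrix.conjTranspose_mul, Matrix.conjTranspose_mul, hadamardAll_conjTranspose,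
        ← mul_assoc (hadamardAll n) _ (hadamardAll n), hadamardAll_conj_mul,
        majoranaProd_mul_conjTranspose, mul_one, hadamardAll_mul_self]
    · intro y z hyz
      have key : ∀ (j : ℕ) (hj : j < n), y ⟨j, hj⟩ = z ⟨j, hj⟩ := by
        intro j
        induction j with
        | zero => intro _; exact pauliSign_injective (hyz _ (Or.inl rfl))
        | succ j ih =>
          intro hj
          have h1 := hyz _ (Or.inr ⟨⟨j, by omega⟩, rfl⟩)
          simp only [ih (by omega)] at h1
          refine pauliSign_injective (mul_left_cancel₀ ?_ h1)
          exact left_ne_zero_of_mul_eq_one (pauliSign_mul_self _)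
      exact funext fun j => key j.val j.2
    · rintro _ (rfl | ⟨i, rfl⟩) y
      · exact pauliSign_mul_self _
      · exact hsq _ _
    · rintro _ (rfl | ⟨i, rfl⟩)
      · rw [h₀, if_pos h.2, one_smul]
      · rw [h₁ i, if_pos (h.1 i), one_smul]
  · by_cases h2 : (⟨0, by omega⟩ : Fin (2 * n)) ∈ S
    · obtain ⟨i, hi⟩ : ∃ i, ¬ (innerOddIndex n i ∈ S ↔ innerEvenIndex n i ∈ S) := by
        by_contra hc
        push Not at hc
        exact h ⟨hc, h2⟩
      have hz : (hadamardAll n * majoranaProd S * hadamardAll n) x x = 0 :=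
        apply_self_eq_zero_of_diagonal_conj (fun _ => hsq _ _)
          (by rw [h₁ i, if_neg hi, neg_one_smul]) x
      rw [hz, zero_mul]
    · have hz : (hadamardAll n * majoranaProd S * hadamardAll n) x x = 0 :=
        apply_self_eq_zero_of_diagonal_conj (fun _ => pauliSign_mul_self _)
          (by rw [h₀, if_neg h2, neg_one_smul]) x
      rw [hz, zero_mul]

open Classical in
theorem card_filter_innerIndex (hn : 0 < n) (l : ℕ) :
    ((Finset.powersetCard (2 * l + 1) (Finset.univ : Finset (Fin (2 * n)))).filter fun S =>
      (∀ i, innerOddIndex n i ∈ S ↔ innerEvenIndex n i ∈ S) ∧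
        (⟨0, by omega⟩ : Fin (2 * n)) ∈ S).card = (n - 1).choose l := by
  have hd : ∀ i j, innerOddIndex n i ≠ innerEvenIndex n j := fun i j h => by
    have := congrArg Fin.val h
    rw [innerOddIndex_val, innerEvenIndex_val] at this; omega
  set a₀ : Fin (2 * n) := ⟨0, by omega⟩ with ha₀
  have hR : ∀ a ∈ ({a₀} : Finset (Fin (2 * n))), ∀ j, a ≠ innerOddIndex n j ∧
      a ≠ innerEvenIndex n j := by
    intro a ha j
    rw [Finset.mem_singleton] at ha
    subst ha
    constructor <;> intro h <;> have := congrArg Fin.val h <;>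
      simp [innerOddIndex, innerEvenIndex, ha₀] at this
  have h1 := card_filter_paired hd hR l
  rw [Finset.card_singleton] at h1
  rw [← h1]
  congr 1
  ext S
  simp only [Finset.mem_filter, and_congr_right_iff, Finset.mem_powersetCard]
  rintro ⟨_, hcard⟩ hpair
  have hmem : a₀ ∈ S ↔ a₀ ∈ unpairedPart (innerOddIndex n) (innerEvenIndex n) S := by
    simp only [unpairedPart, Finset.mem_filter, iff_self_and]
    exact fun _ => hR a₀ (Finset.mem_singleton_self _)
  rw [hmem]
  refine ⟨fun h0 => ?_, fun h => by rw [h]; exact Finset.mem_singleton_self _⟩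
  -- the only unpaired indices are `0` and `2n - 1`, and the parity of `S` excludes having both
  have hle : (unpairedPart (innerOddIndex n) (innerEvenIndex n) S) ⊆
      {a₀, ⟨2 * n - 1, by omega⟩} := by
    intro a ha
    have ha' := (Finset.mem_filter.mp ha).2
    have ha2 := a.2
    rw [Finset.mem_insert, Finset.mem_singleton]
    by_contra hc
    push Not at hc
    have hc1 : a.val ≠ 0 := fun e => hc.1 (Fin.ext e)
    have hc2 : a.val ≠ 2 * n - 1 := fun e => hc.2 (Fin.ext e)
    rcases Nat.mod_two_eq_zero_or_one a.val with h2 | h2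
    · exact (ha' ⟨a.val / 2 - 1, by omega⟩).2 (Fin.ext (by
        rw [innerEvenIndex_val]; dsimp only; omega))
    · exact (ha' ⟨a.val / 2, by omega⟩).1 (Fin.ext (by
        rw [innerOddIndex_val]; dsimp only; omega))
  have hc := card_of_paired hd hpair
  rw [hcard] at hc
  have hc2 := (Finset.card_le_card hle).trans Finset.card_le_two
  obtain ⟨b, hb⟩ := Finset.card_eq_one.mp (show
    (unpairedPart (innerOddIndex n) (innerEvenIndex n) S).card = 1 by omega)
  rw [hb] at h0 ⊢
  rw [Finset.mem_singleton.mp h0]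

theorem normX_ne_zero {k : ℕ} (hk : k ≤ 2 * n) (hodd : Odd k) : normX n k ≠ 0 := by
  obtain ⟨l, rfl⟩ := hodd
  have h1 : ((n - 1).choose ((2 * l + 1) / 2) : ℝ) ≠ 0 :=
    Nat.cast_ne_zero.mpr (Nat.choose_pos (by omega)).ne'
  have h2 : ((2 * n).choose (2 * l + 1) : ℝ) ≠ 0 := Nat.cast_ne_zero.mpr (Nat.choose_pos hk).ne'
  have h3 : (2 ^ n : ℝ) ≠ 0 := by positivity
  exact mul_ne_zero (mul_ne_zero (inv_ne_zero h3) (pow_ne_zero _ h1)) (inv_ne_zero h2)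

theorem amplitude_xEffect (hn : 0 < n) {k : ℕ} (hk : Odd k) (N : ℝ) :
    amplitude k N (xEffect (n := n) 0) xEffect LinearMap.id (xEffect 0) xEffect =
      (N : ℂ)⁻¹ * (normX n k : ℂ) := by
  classical
  rw [amplitude_id_eq N xEffect_conjTranspose
    (fun S => (∀ i, innerOddIndex n i ∈ S ↔ innerEvenIndex n i ∈ S) ∧
      (⟨0, by omega⟩ : Fin (2 * n)) ∈ S) fun x S hS => trace_xEffect_mul_star hn x (hS ▸ hk)]
  obtain ⟨l, rfl⟩ := hk
  rw [card_filter_innerIndex hn, normX, show (2 * l + 1) / 2 = l by omega]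

end Normalization

end MatchgateBenchmarking

theorem mainTheorem5 (n : ℕ) (hn : 1 ≤ n) :
    -- gate-independent noise
    (∀ Λ : MatchgateBenchmarking.SuperOp n, MatchgateBenchmarking.IsChannel Λ →
      -- exact exponential decay, for arbitrary SPAM
      (∀ Φ : Matrix.orthogonalGroup (Fin (2 * n)) ℝ → MatchgateBenchmarking.SuperOp n,
        (∀ Q, Φ Q = Λ ∘ₗ MatchgateBenchmarking.omega Q) →
        ∀ (ρ₀ ρ' : MatchgateBenchmarking.Op n)
          (E E' : MatchgateBenchmarking.Bits n → MatchgateBenchmarking.Op n),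
          MatchgateBenchmarking.IsDensity ρ₀ → MatchgateBenchmarking.IsDensity ρ' →
          MatchgateBenchmarking.IsPOVM E → MatchgateBenchmarking.IsPOVM E' →
          ∀ k ≤ 2 * n, ∀ N : ℝ,
            (∀ m : ℕ, 1 ≤ m →
              MatchgateBenchmarking.decayData k N ρ₀ E Φ ρ' E' m =
                MatchgateBenchmarking.amplitude k N ρ₀ E Λ ρ' E' *
                  MatchgateBenchmarking.majoranaFidelity Λ k ^ (m - 1)) ∧
            (MatchgateBenchmarking.majoranaFidelity Λ k ≠ 0 → ∀ m : ℕ, 1 ≤ m →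
              MatchgateBenchmarking.decayData k N ρ₀ E Φ ρ' E' m =
                (MatchgateBenchmarking.amplitude k N ρ₀ E Λ ρ' E' /
                    MatchgateBenchmarking.majoranaFidelity Λ k) *
                  MatchgateBenchmarking.majoranaFidelity Λ k ^ m)) ∧
      -- the Majorana fidelities are real and determine the average gate fidelity
      (∀ k ≤ 2 * n, (MatchgateBenchmarking.majoranaFidelity Λ k).im = 0) ∧
      ((2 : ℂ) ^ n)⁻¹ * ∑ k ∈ Finset.range (2 * n + 1),
          ((2 * n).choose k : ℂ) * MatchgateBenchmarking.majoranaFidelity Λ k =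
        ((2 : ℂ) ^ n + 1) * MatchgateBenchmarking.avgFidelity Λ - 1) ∧
    -- the noise-free limit: `Λ = id`, ideal state preparation and measurement
    (∀ k ≤ 2 * n, MatchgateBenchmarking.majoranaFidelity
      (LinearMap.id : MatchgateBenchmarking.SuperOp n) k = 1) ∧
    (∀ k ≤ 2 * n, Even k →
      (∀ N : ℝ, MatchgateBenchmarking.amplitude k N
          (MatchgateBenchmarking.zState n) MatchgateBenchmarking.zEffect LinearMap.id
          (MatchgateBenchmarking.zState n) MatchgateBenchmarking.zEffect = 1 ↔
        N = MatchgateBenchmarking.normZ n k) ∧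
      ∀ m : ℕ, 1 ≤ m → MatchgateBenchmarking.decayData k (MatchgateBenchmarking.normZ n k)
        (MatchgateBenchmarking.zState n) MatchgateBenchmarking.zEffect
        MatchgateBenchmarking.omega
        (MatchgateBenchmarking.zState n) MatchgateBenchmarking.zEffect m = 1) ∧
    (∀ k ≤ 2 * n, Odd k →
      (∀ N : ℝ, MatchgateBenchmarking.amplitude k N
          (MatchgateBenchmarking.xState n) MatchgateBenchmarking.xEffect LinearMap.id
          (MatchgateBenchmarking.xState n) MatchgateBenchmarking.xEffect = 1 ↔
        N = MatchgateBenchmarking.normX n k) ∧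
      ∀ m : ℕ, 1 ≤ m → MatchgateBenchmarking.decayData k (MatchgateBenchmarking.normX n k)
        (MatchgateBenchmarking.xState n) MatchgateBenchmarking.xEffect
        MatchgateBenchmarking.omega
        (MatchgateBenchmarking.xState n) MatchgateBenchmarking.xEffect m = 1) := by

  open MatchgateBenchmarking in
  refine ⟨fun Λ hΛ => ⟨?_, fun k _ => hΛ.majoranaFidelity_im k, ?_⟩,
    fun k hk => majoranaFidelity_id hk, fun k hk heven => ?_, fun k hk hodd => ?_⟩
  · intro Φ hΦ ρ₀ ρ' E E' _ _ hE hE' k _ N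
    have key : ∀ m : ℕ, 1 ≤ m → decayData k N ρ₀ E Φ ρ' E' m =
        amplitude k N ρ₀ E Λ ρ' E' * majoranaFidelity Λ k ^ (m - 1) := by
      intro m hm
      obtain ⟨m, rfl⟩ := Nat.exists_eq_add_of_le' hm
      exact decayData_eq Λ hΦ ρ₀ ρ' (fun x => (hE.1 x).isHermitian)
        (fun x => (hE'.1 x).isHermitian) k N m
    refine ⟨key, fun hl m hm => ?_⟩
    rw [key m hm]
    obtain ⟨m, rfl⟩ := Nat.exists_eq_add_of_le' hm
    rw [Nat.add_sub_cancel, pow_succ']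
    field_simp
  · rw [sum_choose_mul_majoranaFidelity, avgFidelity_eq Λ hΛ.2]
    have h1 : (2 : ℂ) ^ n ≠ 0 := by positivity
    have h2 : (2 : ℂ) ^ n + 1 ≠ 0 := by exact_mod_cast (Nat.succ_ne_zero (2 ^ n))
    field_simp
    ring
  · have h := amplitude_eq_one_iff (normZ_ne_zero hk) (amplitude_zEffect heven)
    exact ⟨h, fun m hm => decayData_noiseless hk zEffect_conjTranspose ((h _).mpr rfl) hm⟩
  · have h := amplitude_eq_one_iff (normX_ne_zero hk hodd) (amplitude_xEffect hn hodd)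
    exact ⟨h, fun m hm => decayData_noiseless hk xEffect_conjTranspose ((h _).mpr rfl) hm⟩
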